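/- For a Young diagram $\lambda$ with $n\ge 1$ boxes let $r(\lambda)$ and $c(\lambda)$ denote the numbers of its rows and columns, let $\rho^\lambda$ be the irreducible complex representation of the symmetric group $S_n$ associated with $\lambda$, realized as follows. Number the boxes of $\lambda$ by $1,\dots,n$; let $P_\lambda$ (respectively $Q_\lambda$) be the group of permutations in $S_n$ that preserve each row (respectively each column) of $\lambda$, and let $$c_\lambda=\Big(\sum_{\sigma\in Q_\lambda}\operatorname{sgn}(\sigma)\,\sigma\Big)\Big(\sum_{\sigma\in P_\lambda}\sigma\Big)\in\mathbb{C}[S_n];$$ then $\rho^\lambda$ is the action of $S_n$ by left multiplication on the left ideal $\mathbb{C}[S_n]\,c_\lambda$ (up to isomorphism it does not depend on the numbering). For $\pi\in S_n$ let $$\chi^\lambda(\pi)=\frac{\operatorname{Tr}\rho^\lambda(\pi)}{\operatorname{Tr}\rho^\lambda(e)}$$ be the character rescaled so that $\chi^\lambda(e)=1$, and let $|\pi|$ be the minimal number of factors needed to write $\pi$ as a product of transpositions. **Theorem.** There exists an absolute constant $a>0$ such that for every $n\ge 1$, every Young diagram $\lambda$ with $n$ boxes and every $\pi\in S_n$,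 $$|\chi^\lambda(\pi)|\le\left[a\max\left(\frac{r(\lambda)}{n},\frac{c(\lambda)}{n},\frac{|\pi|}{n}\right)\right]^{|\pi|}.$$ -/

import Mathlib

namespace SymChar

/-- `|π|`: the minimal number of factors needed to write `π` as a product of transpositions. -/
noncomputable def permLength {n : ℕ} (π : Equiv.Perm (Fin n)) : ℕ :=
  sInf {k : ℕ | ∃ l : List (Equiv.Perm (Fin n)),
    l.length = k ∧ (∀ τ ∈ l, τ.IsSwap) ∧ l.prod = π}

/-- Every permutation is a product of transpositions, so the infimum in `permLength` is taken
over a nonempty set (and hence is attained). -/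
theorem exists_swap_factorization {n : ℕ} (π : Equiv.Perm (Fin n)) :
    ∃ l : List (Equiv.Perm (Fin n)),
      l.length = permLength π ∧ (∀ τ ∈ l, τ.IsSwap) ∧ l.prod = π := by
  have h : {k : ℕ | ∃ l : List (Equiv.Perm (Fin n)),
      l.length = k ∧ (∀ τ ∈ l, τ.IsSwap) ∧ l.prod = π}.Nonempty := by
    obtain ⟨l, hl⟩ := (Equiv.Perm.truncSwapFactors π).out
    exact ⟨l.length, l, rfl, hl.2, hl.1⟩
  exact Nat.sInf_mem h

/-- The number `r(μ)` of rows of a Young diagram (a box `(i, j)` lies in row `i` and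
column `j`, so this is the length of the first column). -/
def numRows (μ : YoungDiagram) : ℕ := μ.colLen 0

/-- The number `c(μ)` of columns of a Young diagram. -/
def numCols (μ : YoungDiagram) : ℕ := μ.rowLen 0

section YoungSymmetrizer

variable {n : ℕ} {μ : YoungDiagram} (T : Fin n ≃ μ.cells)

/-- For a numbering `T` of the boxes of `μ` by `0, …, n - 1` (a Young tableau of shape `μ`):
the permutations which preserve each row of `T`. -/
def rowStabilizer : Finset (Equiv.Perm (Fin n)) :=
  {σ | ∀ i, (T (σ i)).val.1 = (T i).val.1}

/-- The permutations which preserve each column of `T`. -/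
def colStabilizer : Finset (Equiv.Perm (Fin n)) :=
  {σ | ∀ i, (T (σ i)).val.2 = (T i).val.2}

/-- The row symmetrizer `a = ∑_{σ ∈ P} σ` in the group algebra. -/
noncomputable def rowSymmetrizer : MonoidAlgebra ℂ (Equiv.Perm (Fin n)) :=
  ∑ σ ∈ rowStabilizer T, MonoidAlgebra.of ℂ _ σ

/-- The column antisymmetrizer `b = ∑_{σ ∈ Q} sgn(σ) σ` in the group algebra. -/
noncomputable def colAntisymmetrizer : MonoidAlgebra ℂ (Equiv.Perm (Fin n)) :=
  ∑ σ ∈ colStabilizer T, ((Equiv.Perm.sign σ : ℤ) : ℂ) • MonoidAlgebra.of ℂ _ σ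

/-- The Young symmetrizer `c = b a`. -/
noncomputable def youngSymmetrizer : MonoidAlgebra ℂ (Equiv.Perm (Fin n)) :=
  colAntisymmetrizer T * rowSymmetrizer T

/-- The left ideal `ℂ[S_n] c` of the group algebra generated by the Young symmetrizer. -/
noncomputable def youngIdeal : Ideal (MonoidAlgebra ℂ (Equiv.Perm (Fin n))) :=
  Ideal.span {youngSymmetrizer T}

/-- The irreducible representation `ρ^μ` of `S_n` associated with the Young diagram `μ`:
the action of `S_n` by left multiplication on `ℂ[S_n] c`. Up to isomorphism it does not
depend on the numbering `T` of the boxes. -/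
noncomputable def youngRep : Representation ℂ (Equiv.Perm (Fin n)) (youngIdeal T) :=
  ((Algebra.lsmul ℂ ℂ (youngIdeal T) :
      MonoidAlgebra ℂ (Equiv.Perm (Fin n)) →ₐ[ℂ] Module.End ℂ (youngIdeal T)) :
    MonoidAlgebra ℂ (Equiv.Perm (Fin n)) →* Module.End ℂ (youngIdeal T)).comp
      (MonoidAlgebra.of ℂ (Equiv.Perm (Fin n)))

/-- The rescaled character `χ^μ(π) = Tr ρ^μ(π) / Tr ρ^μ(e)`. -/
noncomputable def normalizedCharacter (π : Equiv.Perm (Fin n)) : ℂ :=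
  LinearMap.trace ℂ (youngIdeal T) (youngRep T π) /
    LinearMap.trace ℂ (youngIdeal T) (youngRep T 1)

end YoungSymmetrizer

end SymChar

/-!
Let `c = b a` be the Young symmetrizer. Since `b x a` is a multiple of `c` for every `x`
(`exists_smul_of_mul`), `c` is proportional to an idempotent, and the trace of `π` on `ℂ[S_n] c` is
proportional to the trace of `x ↦ π x c` on the whole group algebra. As `c` has coefficient `1` at
the identity, this gives (`normalizedCharacter_eq`)
`χ(π) = (1 / n!) ∑ g, c(g⁻¹ π⁻¹ g)`,
where the coefficients of `c` are `0` or `±1` and vanish off the products of a column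
permutation and a row permutation. So `n! |χ(π)|` is at most the number of numberings of the
diagram for which `π⁻¹ = σ₁ σ₂` with `σ₁` preserving columns and `σ₂` preserving rows. Both factors
are supported in the support of `π`; with `k` the size of that support, it remains to count the
triples `(σ₁, σ₂, f)` in which `f` places the `k` points in the diagram compatibly with `σ₁`, `σ₂`
(`card_admissibleTriples_le`).

Let `m` be the largest of `k` and of the numbers of rows and columns. Regard the points as edges of
a bipartite graph whose vertices are the cycles of `σ₁` and the cycles of `σ₂`, and choose a
spanning forest `F` of edges (`exists_spanning_forest`), in at most `2 ^ k` ways. A point `x`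
outside `F` can be deleted from both of its cycles: the position of `x` is determined by the other
points, and the factorization can be recovered from `σ₁ x`, for which there are at most `k ≤ m`
possibilities (`card_cut_le`). On a forest one deletes leaves, that is points fixed by `σ₁` or by
`σ₂`. A leaf shares its column or its row with another point, so its position costs a factor `m`,
except when it is fixed by both permutations, where it costs `n`; the latter happens at most once
per connected component (`card_leaf₁_le`, `card_leaf₂_le`, `card_isolated_le`). Which points are
leaves is found by scanning: a set `S` of points known not to be leaves is carried along, and
deleting a leaf turns at most one point of `S` into a leaf, so that `2 |A| - |S|` decreases and the
scan has at most `9 ^ k` outcomes (`card_forestTriples_le`).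

A component is a union of orbits of `π`, so the number of components is at most `q = k - |π|`
(`permLength_add_card_image_le`), and the count is at most `18 ^ k n ^ q m ^ (k - q)`. Dividing by
`n! / (n - k)! ≥ (n / e) ^ k` leaves `(18 e) ^ k (m / n) ^ |π|`, and `k ≤ 2 |π|`.
-/

namespace SymChar

open Equiv Equiv.Perm

/-! ### Spanning forests of a pair of equivalence relations -/

section SpanningForest

variable {α : Type*}

/-- The labelling `g` is constant on the classes of `r₁` and of `r₂` inside `A`. The number of
connected components of `A` is the largest number of values of such a labelling, and it is in this
form that components are counted. -/
def ConstOn (r₁ r₂ : α → α → Prop) (A : Finset α) (g : α → ℕ) : Prop :=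
  ∀ a ∈ A, ∀ b ∈ A, r₁ a b ∨ r₂ a b → g a = g b

/-- Regard each point as an edge joining its `r₁`-class to its `r₂`-class. The set `F` of edges is
a forest if every nonempty subset contains an edge with an endpoint on no other edge of the
subset. -/
def IsForest (r₁ r₂ : α → α → Prop) (F : Finset α) : Prop :=
  ∀ B ⊆ F, B.Nonempty → ∃ x ∈ B, (∀ y ∈ B, r₁ x y → y = x) ∨ (∀ y ∈ B, r₂ x y → y = x)

/-- The edges in `F` touch all the vertices touched by `A` and connect the same vertices:
labellings constant on the components of `F` extend to `A`. -/
structure IsSpanning (r₁ r₂ : α → α → Prop) (A F : Finset α) : Prop where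
  subset : F ⊆ A
  exists₁ : ∀ a ∈ A, ∃ y ∈ F, r₁ a y
  exists₂ : ∀ a ∈ A, ∃ y ∈ F, r₂ a y
  extend : ∀ g, ConstOn r₁ r₂ F g → ∃ g', ConstOn r₁ r₂ A g' ∧ ∀ a ∈ F, g' a = g a

theorem IsForest.mono {r₁ r₂ : α → α → Prop} {F F' : Finset α} (h : IsForest r₁ r₂ F)
    (hs : F' ⊆ F) : IsForest r₁ r₂ F' :=
  fun B hB hne => h B (hB.trans hs) hne

variable [DecidableEq α]

/-- The set `K` of edges is a union of components of `B` with `x` deleted, namely of some that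
contain all the edges at the `r₁`-end of `x` and none of those at its `r₂`-end. Such a `K` shows
that `x` is a bridge of `B`. -/
structure IsCut (r₁ r₂ : α → α → Prop) (B : Finset α) (x : α) (K : Finset α) : Prop where
  subset : K ⊆ B.erase x
  closed : ∀ b ∈ K, ∀ b' ∈ B.erase x, r₁ b b' ∨ r₂ b b' → b' ∈ K
  mem : ∀ y ∈ B.erase x, r₁ x y → y ∈ K
  notMem : ∀ z ∈ B.erase x, r₂ x z → z ∉ K

/-- A graph without leaves has an edge that is not a bridge: walk across a bridge `x` into the side
`K`, to an edge `y` adjacent to `x`; the far side of `y` is properly contained in `K`. The induction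
is on the size of `K`, and the two relations exchange roles at each step. -/
theorem not_isCut {B : Finset α} (n : ℕ) :
    ∀ {r₁ r₂ : α → α → Prop}, Equivalence r₁ → Equivalence r₂ →
      (∀ x ∈ B, ∃ y ∈ B.erase x, r₁ x y) → (∀ x ∈ B, ∃ y ∈ B.erase x, r₂ x y) →
      (∀ x ∈ B, ∃ K, IsCut r₁ r₂ B x K) → (∀ x ∈ B, ∃ K, IsCut r₂ r₁ B x K) →
      ∀ x ∈ B, ∀ K : Finset α, K.card = n → ¬ IsCut r₁ r₂ B x K := by
  induction n using Nat.strong_induction_on with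
  | _ n ih =>
    intro r₁ r₂ e₁ e₂ h₁ h₂ c₁ c₂ x hx K hK hcut
    obtain ⟨y, hy, hxy⟩ := h₁ x hx
    have hyK := hcut.mem y hy hxy
    have hyB := Finset.mem_of_mem_erase hy
    have hyx := Finset.ne_of_mem_erase hy
    obtain ⟨K', hcut'⟩ := c₂ y hyB
    have hxK' : x ∉ K' := hcut'.notMem x (Finset.mem_erase.2 ⟨hyx.symm, hx⟩) (e₁.symm hxy)
    have hyK' : y ∉ K' := fun h => by simpa using hcut'.subset h
    have hlt : (K' ∩ K).card < n := by
      rw [← hK]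
      refine Finset.card_lt_card (Finset.ssubset_iff_subset_ne.2 ⟨Finset.inter_subset_right, ?_⟩)
      intro h
      exact hyK' (Finset.inter_eq_right.1 h hyK)
    refine ih _ hlt e₂ e₁ h₂ h₁ c₂ c₁ y hyB (K' ∩ K) rfl
      ⟨fun b hb => hcut'.subset (Finset.mem_inter.1 hb).1, ?_, ?_, ?_⟩
    · intro b hb b' hb' hr
      obtain ⟨hb₁, hb₂⟩ := Finset.mem_inter.1 hb
      have hb'K' := hcut'.closed b hb₁ b' hb' hr
      refine Finset.mem_inter.2 ⟨hb'K', hcut.closed b hb₂ b' ?_ hr.symm⟩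
      exact Finset.mem_erase.2 ⟨fun h => hxK' (h ▸ hb'K'), Finset.mem_of_mem_erase hb'⟩
    · intro z hz hr
      have hzK' := hcut'.mem z hz hr
      refine Finset.mem_inter.2 ⟨hzK', hcut.closed y hyK z ?_ (Or.inr hr)⟩
      exact Finset.mem_erase.2 ⟨fun h => hxK' (h ▸ hzK'), Finset.mem_of_mem_erase hz⟩
    · intro z hz hr hzK
      exact hcut'.notMem z hz hr (Finset.mem_inter.1 hzK).1

/-- In a nonempty graph without leaves some edge `x` is not a bridge: its two ends carry the same
label in every labelling constant on the components that remain after deleting `x`. -/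
theorem exists_nonbridge {r₁ r₂ : α → α → Prop} (e₁ : Equivalence r₁) (e₂ : Equivalence r₂)
    {B : Finset α} (hB : B.Nonempty)
    (h₁ : ∀ x ∈ B, ∃ y ∈ B.erase x, r₁ x y) (h₂ : ∀ x ∈ B, ∃ y ∈ B.erase x, r₂ x y) :
    ∃ x ∈ B, ∀ g, ConstOn r₁ r₂ (B.erase x) g →
      ∀ y ∈ B.erase x, ∀ z ∈ B.erase x, r₁ x y → r₂ x z → g y = g z := by
  by_contra! hcon
  have key : ∀ x ∈ B, (∃ K, IsCut r₁ r₂ B x K) ∧ (∃ K, IsCut r₂ r₁ B x K) := by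
    intro x hx
    obtain ⟨g, hg, y, hy, z, hz, hxy, hxz, hne⟩ := hcon x hx
    have hy' : ∀ w ∈ B.erase x, r₁ x w → g w = g y := fun w hw hr =>
      hg w hw y hy (Or.inl (e₁.trans (e₁.symm hr) hxy))
    have hz' : ∀ w ∈ B.erase x, r₂ x w → g w = g z := fun w hw hr =>
      hg w hw z hz (Or.inr (e₂.trans (e₂.symm hr) hxz))
    refine ⟨⟨(B.erase x).filter (fun w => g w = g y), Finset.filter_subset _ _, ?_, ?_, ?_⟩,
      ⟨(B.erase x).filter (fun w => g w = g z), Finset.filter_subset _ _, ?_, ?_, ?_⟩⟩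
    · intro b hb b' hb' hr
      rw [Finset.mem_filter] at hb ⊢
      exact ⟨hb', (hg b hb.1 b' hb' hr).symm.trans hb.2⟩
    · exact fun w hw hr => Finset.mem_filter.2 ⟨hw, hy' w hw hr⟩
    · exact fun w hw hr h => hne ((Finset.mem_filter.1 h).2.symm.trans (hz' w hw hr))
    · intro b hb b' hb' hr
      rw [Finset.mem_filter] at hb ⊢
      exact ⟨hb', (hg b hb.1 b' hb' hr.symm).symm.trans hb.2⟩
    · exact fun w hw hr => Finset.mem_filter.2 ⟨hw, hz' w hw hr⟩
    · exact fun w hw hr h => hne ((hy' w hw hr).symm.trans (Finset.mem_filter.1 h).2)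
  obtain ⟨x, hx⟩ := hB
  obtain ⟨K, hK⟩ := (key x hx).1
  exact not_isCut K.card e₁ e₂ h₁ h₂ (fun x hx => (key x hx).1) (fun x hx => (key x hx).2)
    x hx K rfl hK

/-- A smallest spanning set of edges is a forest, since a subset without leaves would contain an
edge that can be deleted. -/
theorem exists_spanning_forest {r₁ r₂ : α → α → Prop} (e₁ : Equivalence r₁)
    (e₂ : Equivalence r₂) (A : Finset α) :
    ∃ F, IsSpanning r₁ r₂ A F ∧ IsForest r₁ r₂ F := by
  classical
  obtain ⟨F, hF, hmin⟩ := Finset.exists_min_image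
    (A.powerset.filter (fun F => IsSpanning r₁ r₂ A F)) Finset.card
    ⟨A, Finset.mem_filter.2 ⟨Finset.mem_powerset_self A, subset_rfl,
      fun a ha => ⟨a, ha, e₁.refl a⟩, fun a ha => ⟨a, ha, e₂.refl a⟩,
      fun g hg => ⟨g, hg, fun _ _ => rfl⟩⟩⟩
  have hF' := (Finset.mem_filter.1 hF).2
  refine ⟨F, hF', ?_⟩
  by_contra hfor
  unfold IsForest at hfor
  push Not at hfor
  obtain ⟨B, hBF, hB, hleaf⟩ := hfor
  obtain ⟨x, hx, hbr⟩ := exists_nonbridge e₁ e₂ hB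
    (fun x hx => by
      obtain ⟨y, hy, hr, hne⟩ := (hleaf x hx).1
      exact ⟨y, Finset.mem_erase.2 ⟨hne, hy⟩, hr⟩)
    (fun x hx => by
      obtain ⟨y, hy, hr, hne⟩ := (hleaf x hx).2
      exact ⟨y, Finset.mem_erase.2 ⟨hne, hy⟩, hr⟩)
  obtain ⟨y, hyB, hxy, hyx⟩ := (hleaf x hx).1
  obtain ⟨z, hzB, hxz, hzx⟩ := (hleaf x hx).2
  have hy : y ∈ F.erase x := Finset.mem_erase.2 ⟨hyx, hBF hyB⟩
  have hz : z ∈ F.erase x := Finset.mem_erase.2 ⟨hzx, hBF hzB⟩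
  have hspan : IsSpanning r₁ r₂ A (F.erase x) := by
    refine ⟨(Finset.erase_subset _ _).trans hF'.subset, ?_, ?_, ?_⟩
    · intro a ha
      obtain ⟨w, hw, hr⟩ := hF'.exists₁ a ha
      by_cases hwx : w = x
      · exact ⟨y, hy, e₁.trans hr (hwx ▸ hxy)⟩
      · exact ⟨w, Finset.mem_erase.2 ⟨hwx, hw⟩, hr⟩
    · intro a ha
      obtain ⟨w, hw, hr⟩ := hF'.exists₂ a ha
      by_cases hwx : w = x
      · exact ⟨z, hz, e₂.trans hr (hwx ▸ hxz)⟩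
      · exact ⟨w, Finset.mem_erase.2 ⟨hwx, hw⟩, hr⟩
    · intro g hg
      have hyz : g y = g z := hbr g
        (fun a ha b hb => hg a (Finset.erase_subset_erase x hBF ha) b
          (Finset.erase_subset_erase x hBF hb))
        y (Finset.mem_erase.2 ⟨hyx, hyB⟩) z (Finset.mem_erase.2 ⟨hzx, hzB⟩) hxy hxz
      have hxb : ∀ b ∈ F.erase x, r₁ x b ∨ r₂ x b → g y = g b := by
        rintro b hb (hr | hr)
        · exact hg y hy b hb (Or.inl (e₁.trans (e₁.symm hxy) hr))
        · rw [hyz]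
          exact hg z hz b hb (Or.inr (e₂.trans (e₂.symm hxz) hr))
      obtain ⟨g', hg', hext⟩ := hF'.extend (Function.update g x (g y)) (by
        intro a ha b hb hr
        by_cases hax : a = x <;> by_cases hbx : b = x
        · rw [hax, hbx]
        · subst hax
          rw [Function.update_self, Function.update_of_ne hbx]
          exact hxb b (Finset.mem_erase.2 ⟨hbx, hb⟩) hr
        · subst hbx
          rw [Function.update_self, Function.update_of_ne hax]
          exact (hxb a (Finset.mem_erase.2 ⟨hax, ha⟩) (hr.imp e₁.symm e₂.symm)).symm
        · rw [Function.update_of_ne hax, Function.update_of_ne hbx]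
          exact hg a (Finset.mem_erase.2 ⟨hax, ha⟩) b (Finset.mem_erase.2 ⟨hbx, hb⟩) hr)
      refine ⟨g', hg', fun a ha => ?_⟩
      rw [hext a (Finset.mem_of_mem_erase ha), Function.update_of_ne (Finset.ne_of_mem_erase ha)]
  have hle := hmin (F.erase x) (Finset.mem_filter.2
    ⟨Finset.mem_powerset.2 hspan.subset, hspan⟩)
  exact absurd (Finset.card_erase_lt_of_mem (hBF hx)) (not_lt.2 hle)

end SpanningForest

/-! ### Removing a point from its cycle -/

theorem apply_eq_of_sameCycle {α γ : Type*} {σ : Perm α} {g : α → γ} (hg : ∀ y, g (σ y) = g y)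
    {a b : α} (h : σ.SameCycle a b) : g a = g b := by
  obtain ⟨i, rfl⟩ := h
  induction i using Int.induction_on generalizing a with
  | zero => simp
  | succ i ih => rw [add_comm, zpow_add, zpow_one, Perm.mul_apply, hg]; exact ih
  | pred i ih =>
    rw [sub_eq_add_neg, add_comm, zpow_add, zpow_neg_one, Perm.mul_apply, ih,
      ← hg (σ⁻¹ _)]
    simp

section Detach

variable {α : Type*} [DecidableEq α]

/-- The permutation obtained from `σ` by removing `x` from its cycle: `x` becomes a fixed point and
the preimage of `x` is sent to `σ x`. -/
def detach (σ : Perm α) (x : α) : Perm α := swap x (σ x) * σ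

@[simp]
theorem detach_self (σ : Perm α) (x : α) : detach σ x x = x := by simp [detach]

theorem detach_of_fixed {σ : Perm α} {x : α} (h : σ x = x) : detach σ x = σ := by
  simp [detach, h, ← Perm.one_def]

theorem detach_apply_of_eq {σ : Perm α} {x y : α} (h : σ y = x) : detach σ x y = σ x := by
  simp [detach, h]

theorem detach_apply_of_ne {σ : Perm α} {x y : α} (hyx : y ≠ x) (h : σ y ≠ x) :
    detach σ x y = σ y := by
  simp only [detach, Perm.mul_apply]
  exact swap_apply_of_ne_of_ne h (fun h' => hyx (σ.injective h'))

theorem detach_apply_ne {σ : Perm α} {x y : α} (hyx : y ≠ x) : detach σ x y ≠ x := fun h =>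
  hyx ((detach σ x).injective (h.trans (detach_self σ x).symm))

theorem swap_mul_detach (σ : Perm α) (x : α) : swap x (σ x) * detach σ x = σ := by
  simp [detach, ← mul_assoc]

/-- The product after removing `x` from both factors depends only on `π = σ₁ σ₂` and `σ₁ x`. -/
theorem detach_mul_detach (σ₁ σ₂ : Perm α) (x : α) :
    detach σ₁ x * detach σ₂ x =
      swap x (σ₁ x) * swap (σ₁ x) ((σ₁ * σ₂) x) * (σ₁ * σ₂) := by
  have h : σ₁ * swap x (σ₂ x) = swap (σ₁ x) ((σ₁ * σ₂) x) * σ₁ := by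
    rw [Perm.mul_apply, mul_swap_eq_swap_mul]
  calc detach σ₁ x * detach σ₂ x = swap x (σ₁ x) * (σ₁ * swap x (σ₂ x)) * σ₂ := by
        simp only [detach, mul_assoc]
    _ = _ := by rw [h]; simp only [mul_assoc]

theorem detach_mul_detach_of_leaf {σ₁ σ₂ : Perm α} {x : α} (h : σ₁ x = x ∨ σ₂ x = x) :
    detach σ₁ x * detach σ₂ x = detach (σ₁ * σ₂) x := by
  rw [detach_mul_detach]
  rcases h with h | h
  · simp [h, detach, ← Perm.one_def]
  · simp [h, detach, ← Perm.one_def]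

theorem sameCycle_detach_apply (σ : Perm α) (x y : α) : y ≠ x → σ.SameCycle y (detach σ x y) := by
  intro hyx
  by_cases h : σ y = x
  · rw [detach_apply_of_eq h, ← h]; simp [SameCycle.refl]
  · rw [detach_apply_of_ne hyx h]; simp [SameCycle.refl]

theorem sameCycle_detach_iff {σ : Perm α} {x a b : α} (ha : a ≠ x) (hb : b ≠ x) :
    (detach σ x).SameCycle a b ↔ σ.SameCycle a b := by
  constructor
  · intro h
    -- off `x`, the cycles of `σ` are unions of cycles of `detach σ x`
    have := apply_eq_of_sameCycle (σ := detach σ x)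
      (g := fun y => if y = x then (none : Option (Quotient (SameCycle.setoid σ)))
        else some (Quotient.mk _ y)) (by
        intro y
        by_cases hy : y = x
        · simp [hy]
        · simp only [hy, detach_apply_ne hy, if_false, Option.some.injEq]
          exact Quotient.sound (sameCycle_detach_apply σ x y hy).symm) h
    simp only [ha, hb, if_false, Option.some.injEq] at this
    exact Quotient.exact this
  · intro h
    have := apply_eq_of_sameCycle (σ := σ)
      (g := fun y => (Quotient.mk (SameCycle.setoid (detach σ x)) (if y = x then σ x else y))) (by
        intro y
        apply Quotient.sound
        by_cases hy : y = x
        · subst hy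
          by_cases h' : σ y = y <;> simp [h']
        · by_cases h' : σ y = x
          · simp only [h', hy, if_true, if_false]
            rw [← detach_apply_of_eq h']
            exact (sameCycle_apply_left.2 (SameCycle.refl _ _))
          · simp only [h', hy, if_false]
            rw [← detach_apply_of_ne hy h']
            exact (sameCycle_apply_left.2 (SameCycle.refl _ _))) h
    simp only [ha, hb, if_false] at this
    exact Quotient.exact this

theorem IsForest.detach {σ₁ σ₂ : Perm α} {F : Finset α}
    (h : IsForest σ₁.SameCycle σ₂.SameCycle F) (x : α) :
    IsForest (detach σ₁ x).SameCycle (detach σ₂ x).SameCycle (F.erase x) := by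
  intro B hB hne
  have hBx : ∀ y ∈ B, y ≠ x := fun y hy => Finset.ne_of_mem_erase (hB hy)
  obtain ⟨z, hz, hr⟩ := h B (hB.trans (Finset.erase_subset _ _)) hne
  refine ⟨z, hz, hr.imp ?_ ?_⟩ <;> intro hr y hy hzy <;>
    exact hr y hy ((sameCycle_detach_iff (hBx z hz) (hBx y hy)).1 hzy)

end Detach

section Admissible

variable {α β : Type*}

/-- `π = σ₁ σ₂` is a factorization supported in `A`, and `f` places the points of `A` in boxes such
that `σ₁` preserves their columns and `σ₂` their rows. Outside `A` the placement takes the dummy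
value `b₀`, so that placements of `A` may be counted as functions on the whole type. Distinct
points may be placed in the same box. -/
structure IsAdmissible (row col : β → ℕ) (b₀ : β) (π : Perm α) (A : Finset α)
    (σ₁ σ₂ : Perm α) (f : α → β) : Prop where
  mul_eq : σ₁ * σ₂ = π
  fixed₁ : ∀ x ∉ A, σ₁ x = x
  fixed₂ : ∀ x ∉ A, σ₂ x = x
  base : ∀ x ∉ A, f x = b₀
  col_eq : ∀ x, col (f (σ₁ x)) = col (f x)
  row_eq : ∀ x, row (f (σ₂ x)) = row (f x)

variable {row col : β → ℕ} {b₀ : β} {π : Perm α} {A : Finset α} {σ₁ σ₂ : Perm α} {f : α → β}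

theorem mem_of_fixed {σ : Perm α} (h : ∀ x ∉ A, σ x = x) {x : α} (hx : x ∈ A) : σ x ∈ A := by
  by_contra hcon
  exact hcon (by rwa [σ.injective (h _ hcon)])

theorem IsAdmissible.fixed (h : IsAdmissible row col b₀ π A σ₁ σ₂ f) : ∀ x ∉ A, π x = x := by
  intro x hx
  rw [← h.mul_eq, Perm.mul_apply, h.fixed₂ x hx, h.fixed₁ x hx]

variable [DecidableEq α]

theorem eq_update_detach {c : β → ℕ} {σ : Perm α} (h : ∀ x, c (f (σ x)) = c (f x)) (x y : α) :
    c (Function.update f x b₀ (detach σ x y)) = c (Function.update f x b₀ y) := by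
  by_cases hy : y = x
  · rw [hy, detach_self]
  · rw [Function.update_of_ne (detach_apply_ne hy), Function.update_of_ne hy]
    by_cases h' : σ y = x
    · rw [detach_apply_of_eq h', h, ← h', h]
    · rw [detach_apply_of_ne hy h', h]

theorem detach_fixed {σ : Perm α} (h : ∀ x ∉ A, σ x = x) (x : α) :
    ∀ y ∉ A.erase x, detach σ x y = y := by
  intro y hy
  by_cases hyx : y = x
  · rw [hyx, detach_self]
  · have hyA : y ∉ A := fun h => hy (Finset.mem_erase.2 ⟨hyx, h⟩)
    rw [detach_apply_of_ne hyx (by rwa [h y hyA]), h y hyA]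

theorem IsAdmissible.detach (h : IsAdmissible row col b₀ π A σ₁ σ₂ f) (x : α) :
    IsAdmissible row col b₀ (detach σ₁ x * detach σ₂ x) (A.erase x)
      (detach σ₁ x) (detach σ₂ x) (Function.update f x b₀) where
  mul_eq := rfl
  fixed₁ := detach_fixed h.fixed₁ x
  fixed₂ := detach_fixed h.fixed₂ x
  base y hy := by
    by_cases hyx : y = x
    · rw [hyx, Function.update_self]
    · rw [Function.update_of_ne hyx]
      exact h.base y fun h => hy (Finset.mem_erase.2 ⟨hyx, h⟩)
  col_eq := eq_update_detach h.col_eq x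
  row_eq := eq_update_detach h.row_eq x

end Admissible

/-! ### Placements compatible with a factorization -/

section Labels

variable {α β : Type*} [DecidableEq α]

/-- Delete the point `x` from a triple. -/
def detachTriple (b₀ : β) (x : α) (t : Perm α × Perm α × (α → β)) :
    Perm α × Perm α × (α → β) :=
  (detach t.1 x, detach t.2.1 x, Function.update t.2.2 x b₀)

variable {row col : β → ℕ} {b₀ : β} {π : Perm α} {A : Finset α}

/-- After deleting a leaf `x` moved by `π`, a labelling constant on components extends to `x` by
giving it the label of `π x`, which lies in the same component. -/
theorem constOn_update {σ₁ σ₂ : Perm α} {f : α → β}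
    (h : IsAdmissible row col b₀ π A σ₁ σ₂ f) {x : α} (hx : x ∈ A) (hπ : π x ≠ x)
    (hleaf : σ₁ x = x ∨ σ₂ x = x) {g : α → ℕ}
    (hg : ConstOn (detach σ₁ x).SameCycle (detach σ₂ x).SameCycle (A.erase x) g) :
    ConstOn σ₁.SameCycle σ₂.SameCycle A (Function.update g x (g (π x))) := by
  have hmul : σ₁ (σ₂ x) = π x := by rw [← h.mul_eq, Perm.mul_apply]
  have hπA : π x ∈ A.erase x := Finset.mem_erase.2 ⟨hπ, mem_of_fixed h.fixed hx⟩
  have hg' : ∀ a ∈ A.erase x, ∀ b ∈ A.erase x, σ₁.SameCycle a b ∨ σ₂.SameCycle a b →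
      g a = g b := by
    intro a ha b hb hr
    have hax := Finset.ne_of_mem_erase ha
    have hbx := Finset.ne_of_mem_erase hb
    exact hg a ha b hb (hr.imp (sameCycle_detach_iff hax hbx).2 (sameCycle_detach_iff hax hbx).2)
  have hxb : ∀ b ∈ A.erase x, σ₁.SameCycle x b ∨ σ₂.SameCycle x b → g (π x) = g b := by
    intro b hb hr
    have hbx := Finset.ne_of_mem_erase hb
    rcases hleaf with hl | hl
    · have h2 : σ₂.SameCycle x b := hr.resolve_left fun hr => hbx
        ((SameCycle.eq_of_left hr hl).symm)
      -- `σ₂ x` is adjacent to `x` by `σ₂` and to `π x = σ₁ (σ₂ x)` by `σ₁`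
      have hσx : σ₂ x ≠ x := fun h' => hπ (by rw [← hmul, h', hl])
      have hσA : σ₂ x ∈ A.erase x := Finset.mem_erase.2 ⟨hσx, mem_of_fixed h.fixed₂ hx⟩
      rw [← hg' (σ₂ x) hσA (π x) hπA (Or.inl (by rw [← hmul]; simp [SameCycle.refl]))]
      exact hg' _ hσA b hb (Or.inr (sameCycle_apply_left.2 h2))
    · have h1 : σ₁.SameCycle x b := hr.resolve_right fun hr => hbx
        ((SameCycle.eq_of_left hr hl).symm)
      exact hg' _ hπA b hb (Or.inl (by rw [← hmul, hl]; exact sameCycle_apply_left.2 h1))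
  intro a ha b hb hr
  by_cases hax : a = x <;> by_cases hbx : b = x
  · rw [hax, hbx]
  · subst hax
    rw [Function.update_self, Function.update_of_ne hbx]
    exact hxb b (Finset.mem_erase.2 ⟨hbx, hb⟩) hr
  · subst hbx
    rw [Function.update_self, Function.update_of_ne hax]
    exact (hxb a (Finset.mem_erase.2 ⟨hax, ha⟩) (hr.imp SameCycle.symm SameCycle.symm)).symm
  · rw [Function.update_of_ne hax, Function.update_of_ne hbx]
    exact hg' a (Finset.mem_erase.2 ⟨hax, ha⟩) b (Finset.mem_erase.2 ⟨hbx, hb⟩) hr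

theorem image_update_eq {x : α} {g : α → ℕ} (hπ : π x ≠ x) (hπA : π x ∈ A) :
    A.image (Function.update g x (g (π x))) = (A.erase x).image g := by
  ext c
  simp only [Finset.mem_image, Finset.mem_erase]
  constructor
  · rintro ⟨a, ha, rfl⟩
    by_cases hax : a = x
    · exact ⟨π x, ⟨hπ, hπA⟩, by rw [hax, Function.update_self]⟩
    · exact ⟨a, ⟨hax, ha⟩, by rw [Function.update_of_ne hax]⟩
  · rintro ⟨a, ⟨hax, ha⟩, rfl⟩
    exact ⟨a, ha, by rw [Function.update_of_ne hax]⟩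

end Labels

section Counting

variable {α β : Type*} [DecidableEq α] [Fintype α] [Fintype β]

open Classical in
/-- The triples `(σ₁, σ₂, f)` satisfying `IsAdmissible`. -/
noncomputable def admissibleTriples (row col : β → ℕ) (b₀ : β) (π : Perm α) (A : Finset α) :
    Finset (Perm α × Perm α × (α → β)) :=
  {t | IsAdmissible row col b₀ π A t.1 t.2.1 t.2.2}

open Classical in
/-- The admissible triples on `A` for which `F` is a forest meeting every cycle in `A`, with at most
`q` connected components. -/
noncomputable def spannedTriples (row col : β → ℕ) (b₀ : β) (π : Perm α) (A F : Finset α)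
    (q : ℕ) : Finset (Perm α × Perm α × (α → β)) :=
  {t ∈ admissibleTriples row col b₀ π A | IsForest t.1.SameCycle t.2.1.SameCycle F ∧
    (∀ a ∈ A, (∃ y ∈ F, t.1.SameCycle a y) ∧ (∃ y ∈ F, t.2.1.SameCycle a y)) ∧
    ∀ g, ConstOn t.1.SameCycle t.2.1.SameCycle F g → (F.image g).card ≤ q}

open Classical in
/-- The admissible triples on `A` for which the whole of `A` is a forest with at most `q` components
and no point of `S` is a leaf, i.e. fixed by `σ₁` or by `σ₂`. -/
noncomputable def forestTriples (row col : β → ℕ) (b₀ : β) (π : Perm α) (A S : Finset α)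
    (q : ℕ) : Finset (Perm α × Perm α × (α → β)) :=
  {t ∈ admissibleTriples row col b₀ π A | IsForest t.1.SameCycle t.2.1.SameCycle A ∧
    (∀ g, ConstOn t.1.SameCycle t.2.1.SameCycle A g → (A.image g).card ≤ q) ∧
    ∀ x ∈ S, t.1 x ≠ x ∧ t.2.1 x ≠ x}

variable {row col : β → ℕ} {b₀ : β} {π : Perm α} {A : Finset α}

/-- Deleting a leaf `x` moved by `π` can create only one new leaf: `π⁻¹ x` if `σ₁` fixes `x`, and
`π x` if `σ₂` does. -/
theorem detachTriple_mem_forestTriples {S : Finset α} {q : ℕ} {x : α} (hx : x ∈ A) (hxS : x ∉ S)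
    (hπ : π x ≠ x) {t : Perm α × Perm α × (α → β)}
    (ht : t ∈ forestTriples row col b₀ π A S q) (hleaf : t.1 x = x ∨ t.2.1 x = x) :
    detachTriple b₀ x t ∈ forestTriples row col b₀ (detach π x) (A.erase x)
      (S.erase (if t.1 x = x then π⁻¹ x else π x)) q := by
  classical
  simp only [forestTriples, admissibleTriples, Finset.mem_filter, Finset.mem_univ, true_and]
    at ht ⊢
  obtain ⟨hadm, hfor, hq, hS⟩ := ht
  obtain ⟨σ₁, σ₂, f⟩ := t
  simp only [detachTriple] at *
  refine ⟨?_, hfor.detach x, ?_, ?_⟩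
  · have := hadm.detach x
    rwa [detach_mul_detach_of_leaf hleaf, hadm.mul_eq] at this
  · intro g hg
    have := hq _ (constOn_update hadm hx hπ hleaf hg)
    rwa [image_update_eq hπ (mem_of_fixed hadm.fixed hx)] at this
  · intro y hy
    obtain ⟨hy, hyS⟩ := Finset.mem_erase.1 hy
    have hyx : y ≠ x := fun h => hxS (h ▸ hyS)
    obtain ⟨h1, h2⟩ := hS y hyS
    have key : ∀ σ : Perm α, σ y ≠ y → detach σ x y = y → σ y = x ∧ σ x = y := by
      intro σ hσ hd
      by_cases h' : σ y = x
      · rw [detach_apply_of_eq h'] at hd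
        exact ⟨h', hd⟩
      · rw [detach_apply_of_ne hyx h'] at hd
        exact absurd hd hσ
    have hmul : ∀ z, σ₁ (σ₂ z) = π z := fun z => by rw [← hadm.mul_eq, Perm.mul_apply]
    constructor
    · intro hd
      obtain ⟨h3, h4⟩ := key σ₁ h1 hd
      have h5 : σ₁ x ≠ x := by rw [h4]; exact hyx
      rw [if_neg h5, ← hmul, hleaf.resolve_left h5, h4] at hy
      exact hy rfl
    · intro hd
      obtain ⟨h3, h4⟩ := key σ₂ h2 hd
      have h5 : σ₂ x ≠ x := by rw [h4]; exact hyx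
      have h6 := hleaf.resolve_right h5
      rw [if_pos h6] at hy
      apply hy
      rw [eq_inv_iff_eq, ← hmul, h3, h6]

/-- A leaf fixed by `π` is fixed by both factors and forms a component of its own. -/
theorem detachTriple_mem_forestTriples_of_fixed {S : Finset α} {q : ℕ} {x : α} (hx : x ∈ A)
    (hπ : π x = x) {t : Perm α × Perm α × (α → β)}
    (ht : t ∈ forestTriples row col b₀ π A S q) (hleaf : t.1 x = x ∨ t.2.1 x = x) :
    detachTriple b₀ x t ∈ forestTriples row col b₀ π (A.erase x) S (q - 1) ∧ 1 ≤ q := by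
  classical
  simp only [forestTriples, admissibleTriples, Finset.mem_filter, Finset.mem_univ, true_and]
    at ht ⊢
  obtain ⟨hadm, hfor, hq, hS⟩ := ht
  obtain ⟨σ₁, σ₂, f⟩ := t
  simp only [detachTriple] at *
  have hmul : ∀ z, σ₁ (σ₂ z) = π z := fun z => by rw [← hadm.mul_eq, Perm.mul_apply]
  have h2 : σ₂ x = x := by
    rcases hleaf with h | h
    · apply σ₁.injective; rw [hmul, hπ, h]
    · exact h
  have h1 : σ₁ x = x := by
    have := hmul x
    rwa [h2, hπ] at this
  rw [detach_of_fixed h1, detach_of_fixed h2]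
  have hq1 : 1 ≤ q := (Nat.succ_le_of_lt (Finset.card_pos.2 (Finset.image_nonempty.2 ⟨x, hx⟩))).trans
    (hq (fun _ => 0) fun _ _ _ _ _ => rfl)
  refine ⟨⟨?_, hfor.mono (Finset.erase_subset _ _), ?_, hS⟩, hq1⟩
  · have := hadm.detach x
    rwa [detach_of_fixed h1, detach_of_fixed h2, hadm.mul_eq] at this
  · intro g hg
    -- give `x` a fresh label
    obtain ⟨c, hc⟩ := Infinite.exists_notMem_finset ((A.erase x).image g)
    have hne : ∀ b, b ≠ x → ¬ (σ₁.SameCycle x b ∨ σ₂.SameCycle x b) := by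
      rintro b hb (h | h)
      · exact hb (SameCycle.eq_of_left h h1).symm
      · exact hb (SameCycle.eq_of_left h h2).symm
    have := hq (Function.update g x c) (by
      intro a ha b hb hr
      by_cases hax : a = x <;> by_cases hbx : b = x
      · rw [hax, hbx]
      · exact absurd (hax ▸ hr) (hne b hbx)
      · exact absurd (hbx ▸ hr.imp SameCycle.symm SameCycle.symm) (hne a hax)
      · rw [Function.update_of_ne hax, Function.update_of_ne hbx]
        exact hg a (Finset.mem_erase.2 ⟨hax, ha⟩) b (Finset.mem_erase.2 ⟨hbx, hb⟩) hr)
    have him : A.image (Function.update g x c) = insert c ((A.erase x).image g) := by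
      conv_lhs => rw [← Finset.insert_erase hx]
      rw [Finset.image_insert, Function.update_self]
      congr 1
      exact Finset.image_congr fun a ha => Function.update_of_ne (Finset.ne_of_mem_erase ha) _ _
    rw [him, Finset.card_insert_of_notMem hc] at this
    omega

end Counting

/-! ### Counting along a forest by removing leaves -/

section Bounds

theorem eq_of_mul_eq_left {G : Type*} [Group G] {σ₁ σ₂ τ₁ τ₂ π : G} (hσ : σ₁ * σ₂ = π) (hτ : τ₁ * τ₂ = π)
    (h : σ₁ = τ₁) : σ₂ = τ₂ := by
  subst h; exact mul_left_cancel (hσ.trans hτ.symm)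

theorem eq_of_mul_eq_right {G : Type*} [Group G] {σ₁ σ₂ τ₁ τ₂ π : G} (hσ : σ₁ * σ₂ = π) (hτ : τ₁ * τ₂ = π)
    (h : σ₂ = τ₂) : σ₁ = τ₁ := by
  subst h; exact mul_right_cancel (hσ.trans hτ.symm)

variable {α β : Type*} [DecidableEq α]

/-- The arithmetic of one leaf removal; the factor `3` is there because the count splits into three
cases. -/
theorem card_leaf_le_aux {A : Finset α} {x : α} (hx : x ∈ A)
    {k k' m N q p p' : ℕ} (hp : p' + 1 ≤ p) (hP : k ≤ m * k')
    (h : k' * m ^ q ≤ 3 ^ p' * N ^ q * m ^ (A.erase x).card) :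
    3 * (k * m ^ q) ≤ 3 ^ p * N ^ q * m ^ A.card := by
  calc 3 * (k * m ^ q) ≤ 3 * (m * k' * m ^ q) := by gcongr
    _ = 3 * m * (k' * m ^ q) := by ring
    _ ≤ 3 * m * (3 ^ p' * N ^ q * m ^ (A.erase x).card) := by gcongr
    _ = 3 ^ (p' + 1) * N ^ q * m ^ ((A.erase x).card + 1) := by ring
    _ ≤ _ := by
      rw [Finset.card_erase_add_one hx]
      gcongr
      norm_num

variable [Fintype α]

open Classical in
/-- If the deleted triple determines both permutations, the triples over it are counted by the
possible boxes of `x`. -/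
theorem card_filter_detachTriple_le (P : Finset (Perm α × Perm α × (α → β))) (b₀ : β)
    (x : α) (t' : Perm α × Perm α × (α → β)) (B : Finset β)
    (hB : ∀ t ∈ P, detachTriple b₀ x t = t' → t.2.2 x ∈ B)
    (hinj : ∀ t ∈ P, ∀ s ∈ P, detachTriple b₀ x t = t' → detachTriple b₀ x s = t' →
      t.1 = s.1 ∧ t.2.1 = s.2.1) :
    (P.filter fun t => detachTriple b₀ x t = t').card ≤ B.card := by
  refine Finset.card_le_card_of_injOn (fun t => t.2.2 x) ?_ ?_
  · intro t ht
    obtain ⟨h1, h2⟩ := Finset.mem_filter.1 (Finset.mem_coe.1 ht)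
    exact hB t h1 h2
  · intro t ht s hs hts
    obtain ⟨h1, h2⟩ := Finset.mem_filter.1 (Finset.mem_coe.1 ht)
    obtain ⟨h3, h4⟩ := Finset.mem_filter.1 (Finset.mem_coe.1 hs)
    obtain ⟨h5, h6⟩ := hinj t h1 s h3 h2 h4
    refine Prod.ext h5 (Prod.ext h6 (funext fun y => ?_))
    by_cases hy : y = x
    · rw [hy]; exact hts
    · have h7 : Function.update t.2.2 x b₀ = Function.update s.2.2 x b₀ :=
        congrArg (fun t => t.2.2) (h2.trans h4.symm)
      simpa [hy] using congrFun h7 y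

variable [Fintype β]

/-- A finite set of at most `N` boxes, determined by their row and column, in which no row and no
column has more than `m` boxes. -/
structure IsBoxed (row col : β → ℕ) (m N : ℕ) : Prop where
  row_le : ∀ i, (Finset.univ.filter fun b => row b = i).card ≤ m
  col_le : ∀ i, (Finset.univ.filter fun b => col b = i).card ≤ m
  card_le : Fintype.card β ≤ N
  le : m ≤ N
  ext : ∀ b b', row b = row b' → col b = col b' → b = b'

variable {row col : β → ℕ} {b₀ : β} {π : Perm α} {A S : Finset α} {m N q : ℕ}

theorem mem_admissibleTriples {t : Perm α × Perm α × (α → β)} :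
    t ∈ admissibleTriples row col b₀ π A ↔ IsAdmissible row col b₀ π A t.1 t.2.1 t.2.2 := by
  simp [admissibleTriples]

open Classical in
/-- If `σ₁` fixes `x`, then `σ₁` is unchanged by the deletion and determines `σ₂`, and the row of `x`
is that of `σ₂ x = σ₁⁻¹ (π x)`. -/
theorem card_leaf₁_le (hb : IsBoxed row col m N) {x : α} (hx : x ∈ A) (hxS : x ∉ S)
    (hπ : π x ≠ x) :
    ((forestTriples row col b₀ π A S q).filter fun t => t.1 x = x).card ≤
      m * (forestTriples row col b₀ (detach π x) (A.erase x) (S.erase (π⁻¹ x)) q).card := by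
  have hadm : ∀ t ∈ (forestTriples row col b₀ π A S q).filter (fun t => t.1 x = x),
      IsAdmissible row col b₀ π A t.1 t.2.1 t.2.2 ∧ t.1 x = x := fun t ht =>
    ⟨mem_admissibleTriples.1 (Finset.mem_filter.1 (Finset.mem_filter.1 ht).1).1,
      (Finset.mem_filter.1 ht).2⟩
  refine Finset.card_le_mul_card_image_of_maps_to (f := detachTriple b₀ x) ?_ m ?_
  · intro t ht
    have h := hadm t ht
    have := detachTriple_mem_forestTriples hx hxS hπ (Finset.mem_filter.1 ht).1 (Or.inl h.2)
    rwa [if_pos h.2] at this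
  · intro t' _
    refine (card_filter_detachTriple_le _ b₀ x t'
      (Finset.univ.filter fun b => row b = row (t'.2.2 (t'.1⁻¹ (π x)))) ?_ ?_).trans
      (hb.row_le _)
    · rintro t ht rfl
      obtain ⟨h, hl⟩ := hadm t ht
      refine Finset.mem_filter.2 ⟨Finset.mem_univ _, ?_⟩
      have h3 : t.1⁻¹ (π x) = t.2.1 x := by
        rw [inv_eq_iff_eq, ← h.mul_eq, Perm.mul_apply]
      have h4 : t.2.1 x ≠ x := fun h' => hπ (by rw [← h.mul_eq, Perm.mul_apply, h', hl])
      simp only [detachTriple]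
      rw [detach_of_fixed hl, h3, Function.update_of_ne h4, h.row_eq]
    · intro t ht s hs h1 h2
      have ht := hadm t ht
      have hs := hadm s hs
      have h3 : detach t.1 x = detach s.1 x := congrArg Prod.fst (h1.trans h2.symm)
      rw [detach_of_fixed ht.2, detach_of_fixed hs.2] at h3
      exact ⟨h3, eq_of_mul_eq_left ht.1.mul_eq hs.1.mul_eq h3⟩

open Classical in
/-- If `σ₂` fixes `x`, then `σ₂` is unchanged by the deletion and determines `σ₁`, and the column of
`x` is that of `σ₁ x = π x`. -/
theorem card_leaf₂_le (hb : IsBoxed row col m N) {x : α} (hx : x ∈ A) (hxS : x ∉ S)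
    (hπ : π x ≠ x) :
    ((forestTriples row col b₀ π A S q).filter fun t => t.2.1 x = x).card ≤
      m * (forestTriples row col b₀ (detach π x) (A.erase x) (S.erase (π x)) q).card := by
  have hadm : ∀ t ∈ (forestTriples row col b₀ π A S q).filter (fun t => t.2.1 x = x),
      IsAdmissible row col b₀ π A t.1 t.2.1 t.2.2 ∧ t.2.1 x = x := fun t ht =>
    ⟨mem_admissibleTriples.1 (Finset.mem_filter.1 (Finset.mem_filter.1 ht).1).1,
      (Finset.mem_filter.1 ht).2⟩
  have hσ₁ : ∀ t ∈ (forestTriples row col b₀ π A S q).filter (fun t => t.2.1 x = x),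
      t.1 x = π x := fun t ht => by
    rw [← (hadm t ht).1.mul_eq, Perm.mul_apply, (hadm t ht).2]
  refine Finset.card_le_mul_card_image_of_maps_to (f := detachTriple b₀ x) ?_ m ?_
  · intro t ht
    have := detachTriple_mem_forestTriples hx hxS hπ (Finset.mem_filter.1 ht).1
      (Or.inr (hadm t ht).2)
    rwa [if_neg (by rw [hσ₁ t ht]; exact hπ)] at this
  · intro t' _
    refine (card_filter_detachTriple_le _ b₀ x t'
      (Finset.univ.filter fun b => col b = col (t'.2.2 (π x))) ?_ ?_).trans
      (hb.col_le _)
    · rintro t ht rfl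
      refine Finset.mem_filter.2 ⟨Finset.mem_univ _, ?_⟩
      simp only [detachTriple]
      rw [Function.update_of_ne hπ, ← hσ₁ t ht, (hadm t ht).1.col_eq]
    · intro t ht s hs h1 h2
      have ht := hadm t ht
      have hs := hadm s hs
      have h3 : detach t.2.1 x = detach s.2.1 x :=
        congrArg (fun t => t.2.1) (h1.trans h2.symm)
      rw [detach_of_fixed ht.2, detach_of_fixed hs.2] at h3
      exact ⟨eq_of_mul_eq_right ht.1.mul_eq hs.1.mul_eq h3, h3⟩

open Classical in
theorem card_isolated_le (hb : IsBoxed row col m N) {x : α} (hx : x ∈ A)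
    (hπ : π x = x) :
    ((forestTriples row col b₀ π A S q).filter fun t => t.1 x = x ∨ t.2.1 x = x).card ≤
      N * (forestTriples row col b₀ π (A.erase x) S (q - 1)).card := by
  refine Finset.card_le_mul_card_image_of_maps_to (f := detachTriple b₀ x) ?_ N ?_
  · intro t ht
    exact (detachTriple_mem_forestTriples_of_fixed hx hπ (Finset.mem_filter.1 ht).1
      (Finset.mem_filter.1 ht).2).1
  · intro t' _
    refine (card_filter_detachTriple_le _ b₀ x t' Finset.univ (fun _ _ _ => Finset.mem_univ _)
      ?_).trans hb.card_le
    have key : ∀ t ∈ (forestTriples row col b₀ π A S q).filter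
        (fun t => t.1 x = x ∨ t.2.1 x = x), t.1 x = x ∧ t.1 * t.2.1 = π := by
      intro t ht
      obtain ⟨h1, h2⟩ := Finset.mem_filter.1 ht
      have h3 := (mem_admissibleTriples.1 (Finset.mem_filter.1 h1).1).mul_eq
      refine ⟨h2.elim id fun h => ?_, h3⟩
      rw [← h3, Perm.mul_apply, h] at hπ
      exact hπ
    intro t ht s hs h1 h2
    have ht := key t ht
    have hs := key s hs
    have h3 : detach t.1 x = detach s.1 x := congrArg Prod.fst (h1.trans h2.symm)
    rw [detach_of_fixed ht.1, detach_of_fixed hs.1] at h3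
    exact ⟨h3, eq_of_mul_eq_left ht.2 hs.2 h3⟩

theorem exists_leaf {t : Perm α × Perm α × (α → β)}
    (ht : t ∈ forestTriples row col b₀ π A S q) (hA : A.Nonempty) :
    ∃ x ∈ A, t.1 x = x ∨ t.2.1 x = x := by
  classical
  simp only [forestTriples, admissibleTriples, Finset.mem_filter, Finset.mem_univ, true_and] at ht
  obtain ⟨hadm, hfor, -, -⟩ := ht
  obtain ⟨x, hx, h⟩ := hfor A subset_rfl hA
  exact ⟨x, hx, h.imp
    (fun h => h _ (mem_of_fixed hadm.fixed₁ hx) (sameCycle_apply_right.2 (SameCycle.refl _ _)))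
    (fun h => h _ (mem_of_fixed hadm.fixed₂ hx) (sameCycle_apply_right.2 (SameCycle.refl _ _)))⟩

/-- Induction on `p = 2 |A| - |S|`: either a given `x ∉ S` is not a leaf and joins `S`, or it is
deleted, together with at most one element of `S`. -/
theorem card_forestTriples_le (hb : IsBoxed row col m N) (p : ℕ) :
    ∀ (π : Perm α) (A S : Finset α) (q : ℕ), S ⊆ A → 2 * A.card = p + S.card →
      (forestTriples row col b₀ π A S q).card * m ^ q ≤ 3 ^ p * N ^ q * m ^ A.card := by
  classical
  induction p using Nat.strong_induction_on with
  | _ p ih =>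
    intro π A S q hS hp
    rcases A.eq_empty_or_nonempty with rfl | hA
    · have h1 : (forestTriples row col b₀ π ∅ S q).card ≤ 1 := by
        refine Finset.card_le_one.2 fun t ht s hs => ?_
        have ht := mem_admissibleTriples.1 (Finset.mem_filter.1 ht).1
        have hs := mem_admissibleTriples.1 (Finset.mem_filter.1 hs).1
        refine Prod.ext ?_ (Prod.ext ?_ ?_)
        · ext y; rw [ht.fixed₁ y (by simp), hs.fixed₁ y (by simp)]
        · ext y; rw [ht.fixed₂ y (by simp), hs.fixed₂ y (by simp)]
        · ext y; rw [ht.base y (by simp), hs.base y (by simp)]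
      calc _ ≤ 1 * N ^ q := Nat.mul_le_mul h1 (Nat.pow_le_pow_left hb.le q)
        _ ≤ 3 ^ p * N ^ q := Nat.mul_le_mul_right _ (Nat.one_le_pow _ _ (by norm_num))
        _ = _ := by simp
    by_cases hSA : S = A
    · have h0 : forestTriples row col b₀ π A S q = ∅ := by
        refine Finset.eq_empty_of_forall_notMem fun t ht => ?_
        obtain ⟨x, hx, h⟩ := exists_leaf ht hA
        have := (Finset.mem_filter.1 ht).2.2.2 x (hSA ▸ hx)
        exact h.elim this.1 this.2
      simp [h0]
    obtain ⟨x, hxA, hxS⟩ := Finset.exists_of_ssubset (Finset.ssubset_iff_subset_ne.2 ⟨hS, hSA⟩)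
    set P := forestTriples row col b₀ π A S q with hPdef
    have hScard : S.card < A.card :=
      Finset.card_lt_card (Finset.ssubset_iff_subset_ne.2 ⟨hS, hSA⟩)
    have hAx := Finset.card_erase_add_one hxA
    have hins : (insert x S).card = S.card + 1 := Finset.card_insert_of_notMem hxS
    have herase : S ⊆ A.erase x := fun y hy => Finset.mem_erase.2 ⟨fun h => hxS (h ▸ hy), hS hy⟩
    -- the triples in which `x` is not a leaf
    have hN : 3 * ((forestTriples row col b₀ π A (insert x S) q).card * m ^ q) ≤
        3 ^ p * N ^ q * m ^ A.card := by
      have := ih (p - 1) (by omega) π A (insert x S) q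
        (Finset.insert_subset hxA hS) (by omega)
      calc _ ≤ 3 * (3 ^ (p - 1) * N ^ q * m ^ A.card) := by gcongr
        _ = 3 ^ (p - 1 + 1) * N ^ q * m ^ A.card := by ring
        _ = _ := by rw [show p - 1 + 1 = p by omega]
    have hsplit : P.card ≤ (forestTriples row col b₀ π A (insert x S) q).card +
        (P.filter fun t => t.1 x = x ∨ t.2.1 x = x).card := by
      refine (Finset.card_le_card ?_).trans (Finset.card_union_le _ _)
      intro t ht
      by_cases h : t.1 x = x ∨ t.2.1 x = x
      · exact Finset.mem_union_right _ (Finset.mem_filter.2 ⟨ht, h⟩)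
      · refine Finset.mem_union_left _ ?_
        rw [hPdef] at ht
        simp only [forestTriples, Finset.mem_filter] at ht ⊢
        refine ⟨ht.1, ht.2.1, ht.2.2.1, fun y hy => ?_⟩
        rcases Finset.mem_insert.1 hy with rfl | hy
        · exact not_or.1 h
        · exact ht.2.2.2 y hy
    by_cases hπ : π x = x
    · have hL : 3 * ((P.filter fun t => t.1 x = x ∨ t.2.1 x = x).card * m ^ q) ≤
          3 ^ p * N ^ q * m ^ A.card := by
        rcases (P.filter fun t => t.1 x = x ∨ t.2.1 x = x).eq_empty_or_nonempty with h | ⟨t, ht⟩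
        · simp [h]
        · have hq : 1 ≤ q := (detachTriple_mem_forestTriples_of_fixed hxA hπ
            (Finset.mem_filter.1 ht).1 (Finset.mem_filter.1 ht).2).2
          have h1 := card_isolated_le (b₀ := b₀) (S := S) (q := q) hb hxA hπ
          have h2 := ih (p - 2) (by omega) π (A.erase x) S (q - 1) herase (by omega)
          obtain ⟨q, rfl⟩ : ∃ r, q = r + 1 := ⟨q - 1, by omega⟩
          simp only [Nat.add_sub_cancel] at h1 h2
          calc _ ≤ 3 * (N * (forestTriples row col b₀ π (A.erase x) S q).card * m ^ (q + 1)) := by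
                gcongr
            _ = 3 * N * m * ((forestTriples row col b₀ π (A.erase x) S q).card * m ^ q) := by ring
            _ ≤ 3 * N * m * (3 ^ (p - 2) * N ^ q * m ^ (A.erase x).card) := by gcongr
            _ = 3 ^ (p - 2 + 1) * N ^ (q + 1) * m ^ ((A.erase x).card + 1) := by ring
            _ ≤ _ := by
              rw [hAx]
              gcongr
              · norm_num
              · omega
      calc P.card * m ^ q ≤ _ := Nat.mul_le_mul_right _ hsplit
        _ ≤ _ := by rw [add_mul]; omega
    · have hS1 : ∀ y, 2 * (A.erase x).card ≤ (p - 1) + (S.erase y).card := by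
        intro y
        have := Finset.pred_card_le_card_erase (s := S) (a := y)
        omega
      have hstep : ∀ y, (forestTriples row col b₀ (detach π x) (A.erase x) (S.erase y) q).card *
          m ^ q ≤ 3 ^ (2 * (A.erase x).card - (S.erase y).card) * N ^ q *
            m ^ (A.erase x).card := by
        intro y
        have h1 := hS1 y
        have h2 : (S.erase y).card ≤ (A.erase x).card :=
          Finset.card_le_card ((Finset.erase_subset _ _).trans herase)
        exact ih _ (by omega) _ _ _ _ ((Finset.erase_subset _ _).trans herase) (by omega)
      have hL1 := card_leaf_le_aux hxA (p := p) (by have := hS1 (π⁻¹ x); omega)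
        (card_leaf₁_le (b₀ := b₀) (q := q) hb hxA hxS hπ) (hstep _)
      have hL2 := card_leaf_le_aux hxA (p := p) (by have := hS1 (π x); omega)
        (card_leaf₂_le (b₀ := b₀) (q := q) hb hxA hxS hπ) (hstep _)
      have hor : (P.filter fun t => t.1 x = x ∨ t.2.1 x = x).card ≤
          (P.filter fun t => t.1 x = x).card + (P.filter fun t => t.2.1 x = x).card := by
        rw [Finset.filter_or]
        exact Finset.card_union_le _ _
      calc P.card * m ^ q ≤ _ := Nat.mul_le_mul_right _ (hsplit.trans (Nat.add_le_add_left hor _))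
        _ ≤ _ := by
          rw [add_mul, add_mul]
          simp only [← hPdef] at hL1 hL2
          omega

end Bounds

/-! ### Cutting the points outside a spanning forest -/

section Cutting

variable {α β : Type*} [DecidableEq α] [Fintype α] [Fintype β]
variable {row col : β → ℕ} {b₀ : β} {π : Perm α} {A F : Finset α} {m N q : ℕ}

/-- A point outside the forest shares each of its two cycles with a point of the forest. -/
theorem ne_of_mem_spannedTriples {x : α} (hx : x ∈ A) (hxF : x ∉ F)
    {t : Perm α × Perm α × (α → β)} (ht : t ∈ spannedTriples row col b₀ π A F q) :
    t.1 x ≠ x ∧ t.2.1 x ≠ x := by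
  classical
  obtain ⟨-, -, hcov, -⟩ := Finset.mem_filter.1 ht
  obtain ⟨⟨y, hy, hxy⟩, ⟨z, hz, hxz⟩⟩ := hcov x hx
  exact ⟨fun h => hxF (SameCycle.eq_of_left hxy h ▸ hy),
    fun h => hxF (SameCycle.eq_of_left hxz h ▸ hz)⟩

theorem detachTriple_mem_spannedTriples {x : α} (hxF : x ∉ F)
    {t : Perm α × Perm α × (α → β)} (ht : t ∈ spannedTriples row col b₀ π A F q) :
    detachTriple b₀ x t ∈ spannedTriples row col b₀
      (swap x (t.1 x) * swap (t.1 x) (π x) * π) (A.erase x) F q := by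
  classical
  simp only [spannedTriples, mem_admissibleTriples, Finset.mem_filter] at ht ⊢
  obtain ⟨hadm, hfor, hcov, hq⟩ := ht
  obtain ⟨σ₁, σ₂, f⟩ := t
  simp only [detachTriple] at *
  have hF : ∀ y ∈ F, y ≠ x := fun y hy h => hxF (h ▸ hy)
  refine ⟨?_, ?_, ?_, ?_⟩
  · have := hadm.detach x
    rwa [detach_mul_detach, hadm.mul_eq] at this
  · have := hfor.detach x
    rwa [Finset.erase_eq_of_notMem hxF] at this
  · intro a ha
    obtain ⟨hax, haA⟩ := Finset.mem_erase.1 ha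
    obtain ⟨⟨y, hy, hay⟩, ⟨z, hz, haz⟩⟩ := hcov a haA
    exact ⟨⟨y, hy, (sameCycle_detach_iff hax (hF y hy)).2 hay⟩,
      ⟨z, hz, (sameCycle_detach_iff hax (hF z hz)).2 haz⟩⟩
  · intro g hg
    exact hq g fun a ha b hb hr => hg a ha b hb
      (hr.imp (sameCycle_detach_iff (hF a ha) (hF b hb)).2
        (sameCycle_detach_iff (hF a ha) (hF b hb)).2)

open Classical in
/-- For `x` outside the forest, a triple is determined by `σ₁ x` and by what remains after deleting
`x`: the box of `x` lies in the column of `σ₁ x` and in the row of `σ₂ x`. -/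
theorem card_cut_le (hb : IsBoxed row col m N) {x : α} (hx : x ∈ A) (hxF : x ∉ F) (u : α) :
    ((spannedTriples row col b₀ π A F q).filter fun t => t.1 x = u).card ≤
      (spannedTriples row col b₀ (swap x u * swap u (π x) * π) (A.erase x) F q).card := by
  refine Finset.card_le_card_of_injOn (detachTriple b₀ x) ?_ ?_
  · intro t ht
    obtain ⟨ht', rfl⟩ := Finset.mem_filter.1 (Finset.mem_coe.1 ht)
    exact detachTriple_mem_spannedTriples hxF ht'
  · intro t ht s hs hts
    obtain ⟨ht, htu⟩ := Finset.mem_filter.1 (Finset.mem_coe.1 ht)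
    obtain ⟨hs, hsu⟩ := Finset.mem_filter.1 (Finset.mem_coe.1 hs)
    have htx := ne_of_mem_spannedTriples hx hxF ht
    have hta := mem_admissibleTriples.1 (Finset.mem_filter.1 ht).1
    have hsa := mem_admissibleTriples.1 (Finset.mem_filter.1 hs).1
    have h1 : t.1 = s.1 := by
      rw [← swap_mul_detach t.1 x, ← swap_mul_detach s.1 x, htu, hsu]
      exact congrArg (swap x u * ·) (congrArg Prod.fst hts)
    have h2 : t.2.1 = s.2.1 := eq_of_mul_eq_left hta.mul_eq hsa.mul_eq h1
    have h3 : Function.update t.2.2 x b₀ = Function.update s.2.2 x b₀ :=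
      congrArg (fun t => t.2.2) hts
    have h4 : ∀ y, y ≠ x → t.2.2 y = s.2.2 y := fun y hy => by simpa [hy] using congrFun h3 y
    refine Prod.ext h1 (Prod.ext h2 (funext fun y => ?_))
    by_cases hy : y = x
    · subst hy
      refine hb.ext _ _ ?_ ?_
      · rw [← hta.row_eq, h4 _ htx.2, h2, hsa.row_eq]
      · rw [← hta.col_eq, h4 _ htx.1, h1, hsa.col_eq]
    · exact h4 y hy

theorem card_spannedTriples_le (hb : IsBoxed row col m N) (d : ℕ) :
    ∀ (π : Perm α) (A : Finset α), F ⊆ A → A.card ≤ m → A.card = d + F.card →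
      (spannedTriples row col b₀ π A F q).card * m ^ q ≤ 9 ^ F.card * N ^ q * m ^ A.card := by
  classical
  induction d with
  | zero =>
    intro π A hF _ hd
    obtain rfl : F = A := Finset.eq_of_subset_of_card_le hF (by omega)
    have h := card_forestTriples_le (b₀ := b₀) hb (2 * F.card) π F ∅ q (Finset.empty_subset _)
      (by simp)
    rw [pow_mul] at h
    refine le_trans (Nat.mul_le_mul_right _ (Finset.card_le_card fun t ht => ?_)) h
    obtain ⟨h1, h2, -, h4⟩ := Finset.mem_filter.1 ht
    exact Finset.mem_filter.2 ⟨h1, h2, h4, by simp⟩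
  | succ d ih =>
    intro π A hF hA hd
    obtain ⟨x, hx, hxF⟩ := Finset.exists_of_ssubset (s₁ := F) (s₂ := A)
      (Finset.ssubset_iff_subset_ne.2 ⟨hF, fun h => by rw [h] at hd; omega⟩)
    have hcard := Finset.card_erase_add_one hx
    have hsub : spannedTriples row col b₀ π A F q ⊆
        A.biUnion fun u => (spannedTriples row col b₀ π A F q).filter fun t => t.1 x = u := by
      intro t ht
      refine Finset.mem_biUnion.2 ⟨t.1 x, ?_, Finset.mem_filter.2 ⟨ht, rfl⟩⟩
      exact mem_of_fixed (mem_admissibleTriples.1 (Finset.mem_filter.1 ht).1).fixed₁ hx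
    calc _ ≤ (∑ u ∈ A, (spannedTriples row col b₀
            (swap x u * swap u (π x) * π) (A.erase x) F q).card) * m ^ q :=
          Nat.mul_le_mul_right _ ((Finset.card_le_card hsub).trans
            (Finset.card_biUnion_le.trans (Finset.sum_le_sum fun u _ =>
              card_cut_le hb hx hxF u)))
      _ = ∑ u ∈ A, (spannedTriples row col b₀
            (swap x u * swap u (π x) * π) (A.erase x) F q).card * m ^ q := Finset.sum_mul _ _ _
      _ ≤ ∑ _u ∈ A, 9 ^ F.card * N ^ q * m ^ (A.erase x).card :=
          Finset.sum_le_sum fun u _ => ih _ _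
            (fun y hy => Finset.mem_erase.2 ⟨fun h => hxF (h ▸ hy), hF hy⟩) (by omega) (by omega)
      _ = A.card * (9 ^ F.card * N ^ q * m ^ (A.erase x).card) := by
          rw [Finset.sum_const, smul_eq_mul]
      _ ≤ m * (9 ^ F.card * N ^ q * m ^ (A.erase x).card) := Nat.mul_le_mul_right _ hA
      _ = 9 ^ F.card * N ^ q * m ^ A.card := by rw [← hcard]; ring

/-- The bound on triples; `q` bounds the number of orbits of `π` in `A`. Multiplying by `m ^ q`
avoids the truncated exponent `|A| - q`. -/
theorem card_admissibleTriples_le (hb : IsBoxed row col m N) (hA : A.card ≤ m)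
    (hq : ∀ g : α → ℕ, (∀ a ∈ A, g (π a) = g a) → (A.image g).card ≤ q) :
    (admissibleTriples row col b₀ π A).card * m ^ q ≤ 18 ^ A.card * N ^ q * m ^ A.card := by
  classical
  have hsub : admissibleTriples row col b₀ π A ⊆
      A.powerset.biUnion fun F => spannedTriples row col b₀ π A F q := by
    intro t ht
    obtain ⟨F, hspan, hfor⟩ := exists_spanning_forest (SameCycle.equivalence t.1)
      (SameCycle.equivalence t.2.1) A
    refine Finset.mem_biUnion.2 ⟨F, Finset.mem_powerset.2 hspan.subset,
      Finset.mem_filter.2 ⟨ht, hfor, fun a ha => ⟨hspan.exists₁ a ha, hspan.exists₂ a ha⟩, ?_⟩⟩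
    intro g hg
    obtain ⟨g', hg', hext⟩ := hspan.extend g hg
    have hadm := mem_admissibleTriples.1 ht
    have hle := hq g' fun a ha => by
      have ha₂ := mem_of_fixed hadm.fixed₂ ha
      rw [← hadm.mul_eq, Perm.mul_apply,
        hg' _ (mem_of_fixed hadm.fixed₁ ha₂) _ ha₂
          (Or.inl (sameCycle_apply_left.2 (SameCycle.refl _ _)))]
      exact hg' _ ha₂ _ ha (Or.inr (sameCycle_apply_left.2 (SameCycle.refl _ _)))
    rw [← Finset.image_congr (s := F) fun a ha => hext a ha]
    exact (Finset.card_le_card (Finset.image_subset_image hspan.subset)).trans hle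
  calc _ ≤ (∑ F ∈ A.powerset, (spannedTriples row col b₀ π A F q).card) * m ^ q :=
        Nat.mul_le_mul_right _ ((Finset.card_le_card hsub).trans Finset.card_biUnion_le)
    _ = ∑ F ∈ A.powerset, (spannedTriples row col b₀ π A F q).card * m ^ q :=
        Finset.sum_mul _ _ _
    _ ≤ ∑ _F ∈ A.powerset, 9 ^ A.card * N ^ q * m ^ A.card := by
        refine Finset.sum_le_sum fun F hF => ?_
        have hF := Finset.mem_powerset.1 hF
        have hle := Finset.card_le_card hF
        refine (card_spannedTriples_le hb (A.card - F.card) π A hF hA (by omega)).trans ?_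
        gcongr
        norm_num
    _ = 18 ^ A.card * N ^ q * m ^ A.card := by
        rw [Finset.sum_const, Finset.card_powerset, smul_eq_mul, show 18 = 2 * 9 by rfl, mul_pow]
        ring

end Cutting

/-! ### Double cosets of the row and column stabilizers -/

section VonNeumann

variable {n : ℕ} {μ : YoungDiagram} (T : Fin n ≃ μ.cells)

theorem mem_rowStabilizer {σ : Perm (Fin n)} :
    σ ∈ rowStabilizer T ↔ ∀ i, (T (σ i)).val.1 = (T i).val.1 := by
  simp [rowStabilizer]

theorem mem_colStabilizer {σ : Perm (Fin n)} :
    σ ∈ colStabilizer T ↔ ∀ i, (T (σ i)).val.2 = (T i).val.2 := by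
  simp [colStabilizer]

theorem eq_of_row_col_eq {i j : Fin n} (h₁ : (T i).val.1 = (T j).val.1)
    (h₂ : (T i).val.2 = (T j).val.2) : i = j :=
  T.injective (Subtype.ext (Prod.ext h₁ h₂))

theorem card_filter_row_lt (μ : YoungDiagram) (i k : ℕ) :
    (μ.cells.filter fun b => b.1 = i ∧ b.2 < k).card = min (μ.rowLen i) k := by
  have : (μ.cells.filter fun b => b.1 = i ∧ b.2 < k) =
      {i} ×ˢ Finset.range (min (μ.rowLen i) k) := by
    ext ⟨a, b⟩
    simp only [Finset.mem_filter, YoungDiagram.mem_cells, YoungDiagram.mem_iff_lt_rowLen,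
      Finset.mem_product, Finset.mem_singleton, Finset.mem_range, lt_min_iff]
    constructor
    · rintro ⟨h1, rfl, h2⟩; exact ⟨rfl, h1, h2⟩
    · rintro ⟨rfl, h1, h2⟩; exact ⟨h1, rfl, h2⟩
  rw [this, Finset.card_product, Finset.card_singleton, one_mul, Finset.card_range]

/-- A set of boxes with the row lengths of `μ` and as many boxes as `μ` in the first `k` columns, for
every `k`, is `μ`: row `i` has at most `min (rowLen i) k` boxes in these columns, and the totals
agree, so equality holds in every row. -/
theorem eq_cells_of_card_eq {S : Finset (ℕ × ℕ)}
    (hrow : ∀ i, (S.filter fun b => b.1 = i).card = μ.rowLen i)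
    (hcol : ∀ k, (S.filter fun b => b.2 < k).card = (μ.cells.filter fun b => b.2 < k).card) :
    S = μ.cells := by
  have hle : ∀ i k, (S.filter fun b => b.1 = i ∧ b.2 < k).card ≤ min (μ.rowLen i) k := by
    intro i k
    refine le_min ?_ ?_
    · rw [← hrow i]
      exact Finset.card_le_card fun b hb => by
        simp only [Finset.mem_filter] at hb ⊢
        exact ⟨hb.1, hb.2.1⟩
    · have : (S.filter fun b => b.1 = i ∧ b.2 < k) ⊆ {i} ×ˢ Finset.range k := by
        intro b hb
        simp only [Finset.mem_filter] at hb
        exact Finset.mem_product.2 ⟨by simpa using hb.2.1, by simpa using hb.2.2⟩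
      simpa using Finset.card_le_card this
  obtain ⟨M, hM⟩ : ∃ M, ∀ b ∈ S ∪ μ.cells, b.1 < M := by
    obtain ⟨M, hM⟩ := ((S ∪ μ.cells).image Prod.fst).exists_nat_subset_range
    exact ⟨M, fun b hb => Finset.mem_range.1 (hM (Finset.mem_image_of_mem _ hb))⟩
  have hsum : ∀ (X : Finset (ℕ × ℕ)), X ⊆ S ∪ μ.cells → ∀ k,
      (X.filter fun b => b.2 < k).card =
        ∑ i ∈ Finset.range M, (X.filter fun b => b.1 = i ∧ b.2 < k).card := by
    intro X hX k
    rw [Finset.card_eq_sum_card_fiberwise (f := Prod.fst) (t := Finset.range M)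
      fun b hb => by
        simpa using hM b (hX (Finset.mem_filter.1 (Finset.mem_coe.1 hb)).1)]
    refine Finset.sum_congr rfl fun i _ => ?_
    rw [Finset.filter_filter]
    congr 1
    ext b
    simp only [Finset.mem_filter]
    tauto
  have heq : ∀ i k, (S.filter fun b => b.1 = i ∧ b.2 < k).card = min (μ.rowLen i) k := by
    intro i k
    by_cases hi : i < M
    · have h := hcol k
      rw [hsum S Finset.subset_union_left, hsum μ.cells Finset.subset_union_right] at h
      simp only [card_filter_row_lt] at h
      exact (Finset.sum_eq_sum_iff_of_le fun i _ => hle i k).1 h i (Finset.mem_range.2 hi)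
    · have h0 : μ.rowLen i = 0 := by
        by_contra hne
        have : (i, 0) ∈ μ.cells := by
          rw [YoungDiagram.mem_cells, YoungDiagram.mem_iff_lt_rowLen]; omega
        exact hi (hM _ (Finset.mem_union_right _ this))
      have := hle i k
      rw [h0] at this ⊢
      simpa using this
  ext ⟨i, k⟩
  have hadd : (S.filter fun b => b.1 = i ∧ b.2 < k + 1).card =
      (S.filter fun b => b.1 = i ∧ b.2 < k).card + if (i, k) ∈ S then 1 else 0 := by
    split_ifs with h
    · rw [← Finset.card_insert_of_notMem (a := (i, k)) (by simp)]
      congr 1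
      ext ⟨a, b⟩
      simp only [Finset.mem_filter, Finset.mem_insert, Prod.mk.injEq, Nat.lt_succ_iff_lt_or_eq]
      constructor
      · rintro ⟨h1, rfl, h2 | rfl⟩
        · exact Or.inr ⟨h1, rfl, h2⟩
        · exact Or.inl ⟨rfl, rfl⟩
      · rintro (⟨rfl, rfl⟩ | ⟨h1, rfl, h2⟩)
        · exact ⟨h, rfl, Or.inr rfl⟩
        · exact ⟨h1, rfl, Or.inl h2⟩
    · rw [add_zero]
      congr 1
      ext ⟨a, b⟩
      simp only [Finset.mem_filter, Nat.lt_succ_iff_lt_or_eq]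
      constructor
      · rintro ⟨h1, rfl, h2 | rfl⟩
        · exact ⟨h1, rfl, h2⟩
        · exact absurd h1 h
      · rintro ⟨h1, rfl, h2⟩
        exact ⟨h1, rfl, Or.inl h2⟩
  rw [heq, heq] at hadd
  rw [YoungDiagram.mem_cells, YoungDiagram.mem_iff_lt_rowLen]
  split_ifs at hadd with h
  · exact ⟨fun _ => by omega, fun _ => h⟩
  · exact ⟨fun h' => absurd h' h, fun h' => by omega⟩

theorem card_filter_numbering (P : ℕ × ℕ → Prop) [DecidablePred P] :
    (Finset.univ.filter fun i : Fin n => P (T i).val).card = (μ.cells.filter P).card := by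
  refine Finset.card_bij (fun i _ => (T i).val) ?_ ?_ ?_
  · intro i hi
    exact Finset.mem_filter.2 ⟨(T i).2, (Finset.mem_filter.1 hi).2⟩
  · intro i _ j _ h
    exact T.injective (Subtype.ext h)
  · intro b hb
    obtain ⟨h1, h2⟩ := Finset.mem_filter.1 hb
    exact ⟨T.symm ⟨b, h1⟩, by simpa using h2, by simp⟩

/-- If no two entries of a row are moved by `g` into a common column, the boxes
`(row of i, column of g i)` are distinct and fill the diagram; moving `i` to the entry of that box
is a row permutation, and the rest of `g` is a column permutation. -/
theorem exists_factorization_or_collision (g : Perm (Fin n)) :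
    (∃ σ ∈ colStabilizer T, ∃ τ ∈ rowStabilizer T, g = σ * τ) ∨
      ∃ i j, i ≠ j ∧ (T i).val.1 = (T j).val.1 ∧ (T (g i)).val.2 = (T (g j)).val.2 := by
  rw [or_iff_not_imp_right]
  intro hcol
  push Not at hcol
  set φ : Fin n → ℕ × ℕ := fun i => ((T i).val.1, (T (g i)).val.2) with hφ
  have hinj : Function.Injective φ := by
    intro i j hij
    by_contra hne
    exact hcol i j hne (show (φ i).1 = (φ j).1 from congrArg _ hij)
      (show (φ i).2 = (φ j).2 from congrArg _ hij)
  have hcard : ∀ (P : ℕ × ℕ → Prop) [DecidablePred P],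
      ((Finset.univ.image φ).filter P).card = (Finset.univ.filter fun i => P (φ i)).card := by
    intro P _
    rw [Finset.filter_image, Finset.card_image_of_injective _ hinj]
  have hS : Finset.univ.image φ = μ.cells := by
    refine eq_cells_of_card_eq ?_ ?_
    · intro i
      rw [hcard, YoungDiagram.rowLen_eq_card]
      exact card_filter_numbering T fun b => b.1 = i
    · intro k
      rw [hcard, ← card_filter_numbering T fun b => b.2 < k]
      exact Finset.card_bij (fun i _ => g i) (by simp [hφ]) (by simp)
        (fun b hb => ⟨g⁻¹ b, by simpa [hφ] using hb, by simp⟩)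
  have hmem : ∀ i, φ i ∈ μ.cells := fun i => by
    rw [← hS]; exact Finset.mem_image_of_mem _ (Finset.mem_univ i)
  have hbij : Function.Bijective (fun i => T.symm ⟨φ i, hmem i⟩) := by
    refine Finite.injective_iff_bijective.1 fun i j hij => hinj ?_
    exact congrArg Subtype.val (T.symm.injective hij)
  set τ : Perm (Fin n) := Equiv.ofBijective _ hbij with hτ
  have hTτ : ∀ i, (T (τ i)).val = φ i := fun i => by simp [hτ]
  refine ⟨g * τ⁻¹, ?_, τ, ?_, by simp⟩
  · rw [mem_colStabilizer]
    intro i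
    obtain ⟨j, rfl⟩ := τ.surjective i
    rw [hTτ]
    simp [hφ]
  · rw [mem_rowStabilizer]
    intro i
    rw [hTτ]

end VonNeumann

/-! ### The Young symmetrizer and the trace formula -/

section Trace

variable {n : ℕ} {μ : YoungDiagram} (T : Fin n ≃ μ.cells)

theorem of_mul_rowSymmetrizer {τ : Perm (Fin n)} (hτ : τ ∈ rowStabilizer T) :
    MonoidAlgebra.of ℂ _ τ * rowSymmetrizer T = rowSymmetrizer T := by
  rw [rowSymmetrizer, Finset.mul_sum]
  simp only [← map_mul]
  rw [mem_rowStabilizer] at hτ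
  refine Finset.sum_equiv (Equiv.mulLeft τ) (fun σ => ?_) (fun _ _ => rfl)
  simp [mem_rowStabilizer, hτ]

theorem colAntisymmetrizer_mul_of {σ : Perm (Fin n)} (hσ : σ ∈ colStabilizer T) :
    colAntisymmetrizer T * MonoidAlgebra.of ℂ _ σ =
      ((Equiv.Perm.sign σ : ℤ) : ℂ) • colAntisymmetrizer T := by
  rw [colAntisymmetrizer, Finset.sum_mul, Finset.smul_sum]
  rw [mem_colStabilizer] at hσ
  refine Finset.sum_equiv (Equiv.mulRight σ) (fun τ => ?_) (fun τ _ => ?_)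
  · simp only [mem_colStabilizer, Equiv.coe_mulRight, Perm.mul_apply]
    refine ⟨fun h i => by rw [h, hσ], fun h i => ?_⟩
    obtain ⟨j, rfl⟩ := σ.surjective i
    rw [h, hσ]
  · simp only [Equiv.coe_mulRight, map_mul, smul_smul, smul_mul_assoc, Units.val_mul, Int.cast_mul]
    congr 1
    rw [mul_comm, mul_assoc, ← Int.cast_mul, ← Units.val_mul, Int.units_mul_self]
    simp

/-- When `g` moves two entries `i`, `j` of a row into one column, `b g a` vanishes: the transposition
`(i j)` is absorbed by `a`, and moved across `g` it changes the sign of `b`. -/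
theorem exists_smul_of_conj (g : Perm (Fin n)) :
    ∃ κ : ℂ, colAntisymmetrizer T * MonoidAlgebra.of ℂ _ g * rowSymmetrizer T =
      κ • youngSymmetrizer T := by
  rcases exists_factorization_or_collision T g with ⟨σ, hσ, τ, hτ, rfl⟩ | ⟨i, j, hij, h1, h2⟩
  · refine ⟨((Equiv.Perm.sign σ : ℤ) : ℂ), ?_⟩
    rw [map_mul, ← mul_assoc, colAntisymmetrizer_mul_of T hσ, mul_assoc,
      of_mul_rowSymmetrizer T hτ, smul_mul_assoc, youngSymmetrizer]
  · refine ⟨0, ?_⟩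
    have hswap : ∀ (c : Fin n → ℕ) (a b : Fin n), c a = c b → ∀ k, c (swap a b k) = c k := by
      intro c a b hab k
      rw [swap_apply_def]
      split_ifs with h1 h2
      · rw [h1, hab]
      · rw [h2, hab]
      · rfl
    have hrow : swap i j ∈ rowStabilizer T :=
      (mem_rowStabilizer T).2 (hswap (fun k => (T k).val.1) i j h1)
    have hcol : swap (g i) (g j) ∈ colStabilizer T :=
      (mem_colStabilizer T).2 (hswap (fun k => (T k).val.2) _ _ h2)
    have hneg : colAntisymmetrizer T * MonoidAlgebra.of ℂ _ g * rowSymmetrizer T =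
        -(colAntisymmetrizer T * MonoidAlgebra.of ℂ _ g * rowSymmetrizer T) := by
      conv_lhs => rw [← of_mul_rowSymmetrizer T hrow, ← mul_assoc, mul_assoc (colAntisymmetrizer T),
        ← map_mul, mul_swap_eq_swap_mul, map_mul, ← mul_assoc, colAntisymmetrizer_mul_of T hcol,
        sign_swap (g.injective.ne hij)]
      simp
    rw [zero_smul]
    have h2 : (2 : ℂ) • (colAntisymmetrizer T * MonoidAlgebra.of ℂ _ g * rowSymmetrizer T) = 0 := by
      rw [two_smul]
      exact eq_neg_iff_add_eq_zero.1 hneg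
    exact (smul_eq_zero.1 h2).resolve_left two_ne_zero

theorem exists_smul_of_mul (x : MonoidAlgebra ℂ (Perm (Fin n))) :
    ∃ κ : ℂ, colAntisymmetrizer T * x * rowSymmetrizer T = κ • youngSymmetrizer T := by
  induction x using MonoidAlgebra.induction_on with
  | of g => exact exists_smul_of_conj T g
  | add x y hx hy =>
    obtain ⟨κ, hκ⟩ := hx
    obtain ⟨κ', hκ'⟩ := hy
    exact ⟨κ + κ', by rw [mul_add, add_mul, hκ, hκ', add_smul]⟩
  | smul r x hx =>
    obtain ⟨κ, hκ⟩ := hx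
    exact ⟨r * κ, by rw [mul_smul_comm, smul_mul_assoc, hκ, smul_smul]⟩

theorem exists_youngSymmetrizer_mul_self :
    ∃ κ : ℂ, youngSymmetrizer T * youngSymmetrizer T = κ • youngSymmetrizer T := by
  obtain ⟨κ, hκ⟩ := exists_smul_of_mul T (rowSymmetrizer T * colAntisymmetrizer T)
  refine ⟨κ, ?_⟩
  rw [← hκ]
  simp only [youngSymmetrizer, mul_assoc]

theorem youngSymmetrizer_coeff (g : Perm (Fin n)) :
    (youngSymmetrizer T).coeff g = ∑ σ ∈ colStabilizer T, ∑ τ ∈ rowStabilizer T,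
      if σ * τ = g then ((Equiv.Perm.sign σ : ℤ) : ℂ) else 0 := by
  classical
  rw [youngSymmetrizer, colAntisymmetrizer, rowSymmetrizer, Finset.sum_mul_sum]
  simp [MonoidAlgebra.coeff_sum, Finsupp.finsetSum_apply, MonoidAlgebra.single_mul_single,
    Finsupp.single_apply]

/-- The factorization of an element as a column permutation times a row permutation is unique. -/
theorem youngSymmetrizer_coeff_mul {σ τ : Perm (Fin n)} (hσ : σ ∈ colStabilizer T)
    (hτ : τ ∈ rowStabilizer T) :
    (youngSymmetrizer T).coeff (σ * τ) = ((Equiv.Perm.sign σ : ℤ) : ℂ) := by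
  have huniq : ∀ σ' ∈ colStabilizer T, ∀ τ' ∈ rowStabilizer T, σ' * τ' = σ * τ → τ' = τ := by
    intro σ' hσ' τ' hτ' h
    rw [mem_colStabilizer] at hσ hσ'
    rw [mem_rowStabilizer] at hτ hτ'
    ext1 i
    refine eq_of_row_col_eq T (by rw [hτ, hτ']) ?_
    rw [← hσ', ← hσ (τ i), ← Perm.mul_apply, ← Perm.mul_apply, h]
  rw [youngSymmetrizer_coeff, Finset.sum_eq_single σ, Finset.sum_eq_single τ]
  · simp
  · intro τ' _ hne
    rw [if_neg fun h => hne (mul_left_cancel h)]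
  · exact fun h => absurd hτ h
  · intro σ' hσ' hne
    refine Finset.sum_eq_zero fun τ' hτ' => if_neg fun h => hne ?_
    rw [huniq σ' hσ' τ' hτ' h] at h
    exact mul_right_cancel h
  · exact fun h => absurd hσ h

theorem youngSymmetrizer_coeff_one : (youngSymmetrizer T).coeff 1 = 1 := by
  have := youngSymmetrizer_coeff_mul T (σ := 1) (τ := 1) ((mem_colStabilizer T).2 fun _ => rfl)
    ((mem_rowStabilizer T).2 fun _ => rfl)
  simpa using this

theorem norm_youngSymmetrizer_coeff_le (g : Perm (Fin n)) [Decidable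
    (∃ σ ∈ colStabilizer T, ∃ τ ∈ rowStabilizer T, σ * τ = g)] :
    ‖(youngSymmetrizer T).coeff g‖ ≤
      if ∃ σ ∈ colStabilizer T, ∃ τ ∈ rowStabilizer T, σ * τ = g then 1 else 0 := by
  split_ifs with h
  · obtain ⟨σ, hσ, τ, hτ, rfl⟩ := h
    rw [youngSymmetrizer_coeff_mul T hσ hτ]
    rcases Int.units_eq_one_or (Equiv.Perm.sign σ) with h | h <;> simp [h]
  · rw [youngSymmetrizer_coeff, Finset.sum_eq_zero, norm_zero]
    intro σ hσ
    refine Finset.sum_eq_zero fun τ hτ => if_neg fun h' => h ⟨σ, hσ, τ, hτ, h'⟩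

/-- The trace of `x ↦ π x c`, computed in the basis of group elements. -/
theorem trace_mul_mul (π : Perm (Fin n)) (c : MonoidAlgebra ℂ (Perm (Fin n))) :
    LinearMap.trace ℂ (MonoidAlgebra ℂ (Perm (Fin n)))
      (LinearMap.mulLeft ℂ (MonoidAlgebra.of ℂ _ π) ∘ₗ LinearMap.mulRight ℂ c) =
      ∑ g : Perm (Fin n), c.coeff (g⁻¹ * π⁻¹ * g) := by
  rw [LinearMap.trace_eq_matrix_trace ℂ (MonoidAlgebra.basis (Perm (Fin n)) ℂ), Matrix.trace]
  refine Finset.sum_congr rfl fun g _ => ?_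
  rw [Matrix.diag_apply, LinearMap.toMatrix_apply]
  have h : (LinearMap.mulLeft ℂ (MonoidAlgebra.of ℂ _ π) ∘ₗ LinearMap.mulRight ℂ c)
      (MonoidAlgebra.basis (Perm (Fin n)) ℂ g) =
      MonoidAlgebra.single (π * g) 1 * c := by
    simp [MonoidAlgebra.basis_apply, ← mul_assoc, MonoidAlgebra.single_mul_single]
  rw [h]
  change (MonoidAlgebra.single (π * g) 1 * c).coeff g = _
  have hg : g = π * g * (g⁻¹ * π⁻¹ * g) := by group
  have h2 := MonoidAlgebra.coeff_single_mul_mul c 1 (π * g) (g⁻¹ * π⁻¹ * g)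
  rwa [← hg, one_mul] at h2

theorem normalizedCharacter_eq (π : Perm (Fin n)) :
    normalizedCharacter T π =
      (∑ g : Perm (Fin n), (youngSymmetrizer T).coeff (g⁻¹ * π⁻¹ * g)) / (n.factorial : ℂ) := by
  obtain ⟨κ, hκ⟩ := exists_youngSymmetrizer_mul_self T
  have key : ∀ π : Perm (Fin n), κ * LinearMap.trace ℂ (youngIdeal T) (youngRep T π) =
      ∑ g : Perm (Fin n), (youngSymmetrizer T).coeff (g⁻¹ * π⁻¹ * g) := by
    intro π
    rw [← trace_mul_mul, ← smul_eq_mul, ← map_smul]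
    -- `x ↦ π x c` maps into the ideal, and acts there as `κ` times `π`
    have hmem : ∀ x, (LinearMap.mulLeft ℂ (MonoidAlgebra.of ℂ _ π) ∘ₗ
        LinearMap.mulRight ℂ (youngSymmetrizer T)) x ∈ (youngIdeal T).restrictScalars ℂ := by
      intro x
      exact Ideal.mul_mem_left _ _ (Ideal.mul_mem_left _ _ (Ideal.subset_span rfl))
    rw [← LinearMap.trace_restrict_eq_of_forall_mem ((youngIdeal T).restrictScalars ℂ) _ hmem]
    change LinearMap.trace ℂ ((youngIdeal T).restrictScalars ℂ) _ = _
    congr 1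
    ext ⟨x, hx⟩ : 1
    apply Subtype.ext
    obtain ⟨y, rfl⟩ := Ideal.mem_span_singleton'.1 hx
    change κ • (MonoidAlgebra.of ℂ _ π * (y * youngSymmetrizer T)) =
      MonoidAlgebra.of ℂ _ π * (y * youngSymmetrizer T * youngSymmetrizer T)
    rw [mul_assoc y, hκ, mul_smul_comm, mul_smul_comm]
  have h1 : κ * LinearMap.trace ℂ (youngIdeal T) (youngRep T 1) = (n.factorial : ℂ) := by
    rw [key]
    simp [youngSymmetrizer_coeff_one, Fintype.card_perm]
  have hn : (n.factorial : ℂ) ≠ 0 := Nat.cast_ne_zero.2 n.factorial_ne_zero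
  -- `κ = 0` would make the trace of the identity element vanish
  have hκ0 : κ ≠ 0 := fun h => hn (by rw [← h1, h, zero_mul])
  rw [normalizedCharacter, ← key π, ← h1, mul_div_mul_left _ _ hκ0]

end Trace

/-! ### The length of a permutation -/

section Length

variable {n : ℕ}

theorem permLength_one : permLength (1 : Perm (Fin n)) = 0 :=
  Nat.sInf_eq_zero.2 (Or.inl ⟨[], rfl, by simp, rfl⟩)

theorem permLength_swap_mul_le {x y : Fin n} (hxy : x ≠ y) (σ : Perm (Fin n)) :
    permLength (swap x y * σ) ≤ permLength σ + 1 := by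
  obtain ⟨l, hl, hswap, hprod⟩ := exists_swap_factorization σ
  refine Nat.sInf_le ⟨swap x y :: l, by simp [hl], ?_, by simp [hprod]⟩
  intro τ hτ
  rcases List.mem_cons.1 hτ with rfl | hτ
  · exact ⟨x, y, hxy, rfl⟩
  · exact hswap τ hτ

/-- The length of `π` is at most the size of its support minus the number of its orbits there, by
removing moved points one at a time. -/
theorem permLength_add_card_image_le (k : ℕ) :
    ∀ (π : Perm (Fin n)) (A : Finset (Fin n)) (g : Fin n → ℕ), A.card = k →
      (∀ x ∉ A, π x = x) → (∀ a ∈ A, g (π a) = g a) →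
      permLength π + (A.image g).card ≤ A.card := by
  induction k with
  | zero =>
    intro π A g hA hπ _
    obtain rfl := Finset.card_eq_zero.1 hA
    obtain rfl : π = 1 := by ext1 x; exact hπ x (by simp)
    simp [permLength_one]
  | succ k ih =>
    intro π A g hA hπ hg
    by_cases h1 : π = 1
    · rw [h1, permLength_one, zero_add]
      exact Finset.card_image_le
    obtain ⟨x, hx⟩ : ∃ x, π x ≠ x := by
      by_contra! h
      exact h1 (by ext1 x; exact h x)
    have hxA : x ∈ A := by
      by_contra h
      exact hx (hπ x h)
    have hcard := Finset.card_erase_add_one hxA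
    have := ih (detach π x) (A.erase x) g (by omega) (detach_fixed hπ x) (by
      intro a ha
      obtain ⟨hax, haA⟩ := Finset.mem_erase.1 ha
      by_cases h : π a = x
      · rw [detach_apply_of_eq h, hg x hxA, ← h, hg a haA]
      · rw [detach_apply_of_ne hax h, hg a haA])
    have him : A.image g = (A.erase x).image g := by
      conv_lhs => rw [← Finset.insert_erase hxA]
      rw [Finset.image_insert, Finset.insert_eq_of_mem]
      exact Finset.mem_image.2 ⟨π x, Finset.mem_erase.2 ⟨hx, mem_of_fixed hπ hxA⟩, hg x hxA⟩
    have hlen : permLength π ≤ permLength (detach π x) + 1 := by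
      conv_lhs => rw [← swap_mul_detach π x]
      exact permLength_swap_mul_le (Ne.symm hx) _
    rw [him]
    omega

theorem card_support_le (π : Perm (Fin n)) : π.support.card ≤ 2 * permLength π := by
  obtain ⟨l, hl, hswap, rfl⟩ := exists_swap_factorization π
  rw [← hl]
  clear hl
  induction l with
  | nil => simp
  | cons τ l ih =>
    have h1 := ih fun σ hσ => hswap σ (List.mem_cons_of_mem _ hσ)
    have h2 : τ.support.card = 2 := card_support_eq_two.2 (hswap τ List.mem_cons_self)
    have h3 := (Finset.card_le_card (support_mul_le τ l.prod)).trans (Finset.card_union_le _ _)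
    rw [List.prod_cons, List.length_cons]
    omega

end Length

/-! ### The bound on characters -/

section Placement

variable {n : ℕ} {μ : YoungDiagram} (T : Fin n ≃ μ.cells)

theorem card_filter_fix {α : Type*} [Fintype α] [DecidableEq α] (A : Finset α) :
    (Finset.univ.filter fun h : Perm α => ∀ x ∈ A, h x = x).card =
      (Fintype.card α - A.card).factorial := by
  rw [← Fintype.card_subtype]
  have e : Perm {x // x ∉ A} ≃ {h : Perm α // ∀ x ∈ A, h x = x} :=
    (Perm.subtypeEquivSubtypePerm (· ∉ A)).trans
      (Equiv.subtypeEquivRight fun h => by simp)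
  rw [← Fintype.card_congr e, Fintype.card_perm]
  congr 1
  rw [Fintype.card_subtype_compl]
  simp

theorem isBoxed_cells (T : Fin n ≃ μ.cells) {m : ℕ} (hr : numRows μ ≤ m) (hc : numCols μ ≤ m)
    (hmn : m ≤ n) :
    IsBoxed (fun b : μ.cells => b.val.1) (fun b : μ.cells => b.val.2) m n where
  row_le i := by
    have : (Finset.univ.filter fun b : μ.cells => b.val.1 = i).card ≤ (μ.row i).card := by
      refine Finset.card_le_card_of_injOn Subtype.val ?_ Subtype.val_injective.injOn
      intro b hb
      exact YoungDiagram.mem_row_iff.2 ⟨(YoungDiagram.mem_cells _).1 b.2, by simpa using hb⟩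
    rw [← YoungDiagram.rowLen_eq_card] at this
    exact this.trans ((μ.rowLen_anti 0 i (Nat.zero_le i)).trans hc)
  col_le i := by
    have : (Finset.univ.filter fun b : μ.cells => b.val.2 = i).card ≤ (μ.col i).card := by
      refine Finset.card_le_card_of_injOn Subtype.val ?_ Subtype.val_injective.injOn
      intro b hb
      exact YoungDiagram.mem_col_iff.2 ⟨(YoungDiagram.mem_cells _).1 b.2, by simpa using hb⟩
    rw [← YoungDiagram.colLen_eq_card] at this
    exact this.trans ((μ.colLen_anti 0 i (Nat.zero_le i)).trans hr)
  card_le := by rw [← Fintype.card_congr T, Fintype.card_fin]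
  le := hmn
  ext b b' h1 h2 := Subtype.ext (Prod.ext h1 h2)

theorem numRows_le (T : Fin n ≃ μ.cells) : numRows μ ≤ n := by
  have h : μ.cells.card = n := by
    rw [← Fintype.card_coe, ← Fintype.card_congr T, Fintype.card_fin]
  rw [numRows, YoungDiagram.colLen_eq_card, ← h]
  exact Finset.card_le_card (Finset.filter_subset _ _)

theorem numCols_le (T : Fin n ≃ μ.cells) : numCols μ ≤ n := by
  have h : μ.cells.card = n := by
    rw [← Fintype.card_coe, ← Fintype.card_congr T, Fintype.card_fin]
  rw [numCols, YoungDiagram.rowLen_eq_card, ← h]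
  exact Finset.card_le_card (Finset.filter_subset _ _)

open Classical in
/-- The `g` such that, in the numbering `T ∘ g⁻¹`, the permutation `ϖ` is the product of a column
permutation and a row permutation. -/
noncomputable def factorizable (ϖ : Perm (Fin n)) : Finset (Perm (Fin n)) :=
  {g | ∃ σ ∈ colStabilizer T, ∃ τ ∈ rowStabilizer T, σ * τ = g⁻¹ * ϖ * g}

theorem norm_normalizedCharacter_le (π : Perm (Fin n)) :
    ‖normalizedCharacter T π‖ ≤ ((factorizable T π⁻¹).card : ℝ) / (n.factorial : ℝ) := by
  classical
  rw [normalizedCharacter_eq, norm_div, Complex.norm_natCast]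
  gcongr
  refine (norm_sum_le _ _).trans ((Finset.sum_le_sum fun g _ =>
    norm_youngSymmetrizer_coeff_le T (g⁻¹ * π⁻¹ * g)).trans (le_of_eq ?_))
  rw [Finset.sum_boole, factorizable]

/-- Both factors are supported in the support of `ϖ`: if `ϖ x = x`, then `τ` keeps `x` in its row
and `σ` brings it back within a column, so `τ` does not move `x`. -/
theorem isAdmissible_of_factorization (b₀ : μ.cells) (ϖ g σ τ : Perm (Fin n))
    (hσ : σ ∈ colStabilizer T) (hτ : τ ∈ rowStabilizer T) (h : σ * τ = g⁻¹ * ϖ * g) :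
    IsAdmissible (fun b : μ.cells => b.val.1) (fun b : μ.cells => b.val.2) b₀ ϖ ϖ.support
      (g * σ * g⁻¹) (g * τ * g⁻¹) (fun x => if x ∈ ϖ.support then T (g⁻¹ x) else b₀) := by
  rw [mem_colStabilizer] at hσ
  rw [mem_rowStabilizer] at hτ
  have hmul : g * σ * g⁻¹ * (g * τ * g⁻¹) = ϖ := by
    calc _ = g * (σ * τ) * g⁻¹ := by group
      _ = ϖ := by rw [h]; group
  have hτfix : ∀ x ∉ ϖ.support, (g * τ * g⁻¹) x = x := by
    intro x hx
    have hx : ϖ x = x := notMem_support.1 hx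
    have h1 : σ (τ (g⁻¹ x)) = g⁻¹ x := by
      have := congrArg (fun p : Perm (Fin n) => p (g⁻¹ x)) h
      simpa [hx] using this
    have h2 : τ (g⁻¹ x) = g⁻¹ x := by
      refine eq_of_row_col_eq T (hτ _) ?_
      rw [← hσ, h1]
    change g (τ (g⁻¹ x)) = x
    rw [h2]
    simp
  have hσfix : ∀ x ∉ ϖ.support, (g * σ * g⁻¹) x = x := by
    intro x hx
    have h1 : (g * σ * g⁻¹) ((g * τ * g⁻¹) x) = ϖ x := by rw [← Perm.mul_apply, hmul]
    rw [hτfix x hx] at h1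
    rw [h1]
    exact notMem_support.1 hx
  refine ⟨hmul, hσfix, hτfix, fun x hx => if_neg hx, fun x => ?_, fun x => ?_⟩
  · by_cases hx : x ∈ ϖ.support
    · simp only [if_pos hx, if_pos (mem_of_fixed hσfix hx)]
      simp [hσ]
    · rw [hσfix x hx]
  · by_cases hx : x ∈ ϖ.support
    · simp only [if_pos hx, if_pos (mem_of_fixed hτfix hx)]
      simp [hτ]
    · rw [hτfix x hx]

/-- The numberings which agree on the support of `ϖ` differ by a permutation of its complement. -/
theorem card_factorizable_le (b₀ : μ.cells) (ϖ : Perm (Fin n)) :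
    (factorizable T ϖ).card ≤ (n - ϖ.support.card).factorial *
      (admissibleTriples (fun b : μ.cells => b.val.1) (fun b : μ.cells => b.val.2) b₀ ϖ
        ϖ.support).card := by
  classical
  refine (Finset.card_le_mul_card_image_of_maps_to
    (f := fun g x => if x ∈ ϖ.support then T (g⁻¹ x) else b₀)
    (t := (admissibleTriples (fun b : μ.cells => b.val.1) (fun b : μ.cells => b.val.2) b₀ ϖ
        ϖ.support).image fun t => t.2.2) ?_ _ ?_).trans
    (Nat.mul_le_mul_left _ Finset.card_image_le)
  · intro g hg
    obtain ⟨σ, hσ, τ, hτ, h⟩ := (Finset.mem_filter.1 hg).2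
    exact Finset.mem_image.2 ⟨(_, _, _), mem_admissibleTriples.2
      (isAdmissible_of_factorization T b₀ ϖ g σ τ hσ hτ h), rfl⟩
  · intro f _
    rcases Finset.eq_empty_or_nonempty ((factorizable T ϖ).filter fun g =>
      (fun x => if x ∈ ϖ.support then T (g⁻¹ x) else b₀) = f) with h | ⟨g₀, hg₀⟩
    · rw [h]; simp
    have hcard := card_filter_fix ϖ.support
    rw [Fintype.card_fin] at hcard
    rw [← hcard]
    refine Finset.card_le_card_of_injOn (fun g => g * g₀⁻¹) ?_
      (fun g _ g' _ h => mul_right_cancel h)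
    intro g hg
    simp only [Finset.coe_filter, Finset.mem_univ, true_and, Set.mem_ofPred_eq]
    intro x hx
    have h1 := congrFun ((Finset.mem_filter.1 hg).2.trans (Finset.mem_filter.1 hg₀).2.symm) x
    simp only [if_pos hx] at h1
    have h2 : g⁻¹ x = g₀⁻¹ x := T.injective h1
    rw [Perm.mul_apply, ← h2]
    simp

theorem pow_mul_factorial_le (n : ℕ) : ∀ k ≤ n,
    (n : ℝ) ^ k * ((n - k).factorial : ℝ) ≤ Real.exp 1 ^ k * (n.factorial : ℝ) := by
  induction n with
  | zero => intro k hk; obtain rfl := Nat.le_zero.1 hk; simp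
  | succ n ih =>
    rintro (_ | k) hk
    · simp
    · have hk : k ≤ n := by omega
      rcases Nat.eq_zero_or_pos n with rfl | hn
      · obtain rfl := Nat.le_zero.1 hk
        simp
      have hn' : (0 : ℝ) < n := Nat.cast_pos.2 hn
      have h1 : ((n : ℝ) + 1) ^ k ≤ Real.exp 1 * (n : ℝ) ^ k := by
        have h2 : (1 / (n : ℝ) + 1) ^ k ≤ Real.exp 1 := by
          calc (1 / (n : ℝ) + 1) ^ k ≤ Real.exp (1 / n) ^ k := by
                gcongr; exact Real.add_one_le_exp _
            _ = Real.exp (k * (1 / n)) := (Real.exp_nat_mul _ _).symm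
            _ ≤ Real.exp 1 := by
                rw [Real.exp_le_exp, mul_one_div, div_le_one hn']
                exact_mod_cast hk
        calc ((n : ℝ) + 1) ^ k = (1 / (n : ℝ) + 1) ^ k * (n : ℝ) ^ k := by
              rw [← mul_pow]; congr 1; field_simp; ring
          _ ≤ _ := by gcongr
      have h3 := ih k hk
      rw [Nat.succ_sub_succ, Nat.factorial_succ]
      push_cast
      calc ((n : ℝ) + 1) ^ (k + 1) * ((n - k).factorial : ℝ)
          = (n + 1) * (((n : ℝ) + 1) ^ k * ((n - k).factorial : ℝ)) := by ring
        _ ≤ (n + 1) * (Real.exp 1 * (n : ℝ) ^ k * ((n - k).factorial : ℝ)) := by gcongr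
        _ = (n + 1) * Real.exp 1 * ((n : ℝ) ^ k * ((n - k).factorial : ℝ)) := by ring
        _ ≤ (n + 1) * Real.exp 1 * (Real.exp 1 ^ k * (n.factorial : ℝ)) := by gcongr
        _ = _ := by ring

theorem norm_normalizedCharacter_le_pow (π : Perm (Fin n)) {m : ℕ} (hr : numRows μ ≤ m)
    (hc : numCols μ ≤ m) (hk : π.support.card ≤ m) (hmn : m ≤ n) (hm : 0 < m) :
    ‖normalizedCharacter T π‖ ≤
      (18 * Real.exp 1) ^ π.support.card * ((m : ℝ) / n) ^ permLength π := by
  have hn : 0 < n := by omega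
  have b₀ : μ.cells := T ⟨0, hn⟩
  set k := π.support.card with hkdef
  have hsupp : (π⁻¹).support = π.support := support_inv π
  have hfix : ∀ x ∉ π.support, π x = x := fun x hx => notMem_support.1 hx
  have hlen : permLength π ≤ k := by
    have := permLength_add_card_image_le _ π π.support (fun _ => 0) rfl hfix (fun _ _ => rfl)
    omega
  have hcount := card_admissibleTriples_le (b₀ := b₀) (π := π⁻¹) (A := π.support)
    (q := k - permLength π) (isBoxed_cells T hr hc hmn) hk (by
      intro g hg
      have := permLength_add_card_image_le _ π π.support g rfl hfix (by
        intro a ha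
        have := hg (π a) (mem_of_fixed hfix ha)
        simpa using this.symm)
      omega)
  have hfac := card_factorizable_le T b₀ π⁻¹
  rw [hsupp] at hfac
  refine (norm_normalizedCharacter_le T π).trans ?_
  rw [div_le_iff₀ (by positivity)]
  have hn' : (0 : ℝ) < n := Nat.cast_pos.2 hn
  have hm' : (0 : ℝ) < m := Nat.cast_pos.2 hm
  obtain ⟨q, hq⟩ : ∃ q, k = q + permLength π := ⟨k - permLength π, by omega⟩
  have hkq : k - permLength π = q := by omega
  rw [hkq] at hcount
  set W := (admissibleTriples (fun b : μ.cells => b.val.1) (fun b : μ.cells => b.val.2) b₀ π⁻¹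
        π.support).card with hW
  have hcount' : (W : ℝ) * (m : ℝ) ^ q ≤ 18 ^ k * (n : ℝ) ^ q * (m : ℝ) ^ k := by
    exact_mod_cast hcount
  have hWle : (W : ℝ) ≤ 18 ^ k * (n : ℝ) ^ q * (m : ℝ) ^ permLength π := by
    refine le_of_mul_le_mul_right (hcount'.trans (le_of_eq ?_)) (pow_pos hm' q)
    rw [show (m : ℝ) ^ k = m ^ q * m ^ permLength π by rw [← pow_add, ← hq]]
    ring
  have hkn : k ≤ n := hk.trans hmn
  calc ((factorizable T π⁻¹).card : ℝ) ≤ ((n - k).factorial : ℝ) * (W : ℝ) := by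
        exact_mod_cast hfac
    _ ≤ ((n - k).factorial : ℝ) * (18 ^ k * (n : ℝ) ^ q * (m : ℝ) ^ permLength π) := by gcongr
    _ = 18 ^ k * ((m : ℝ) / n) ^ permLength π * ((n : ℝ) ^ k * ((n - k).factorial : ℝ)) := by
        rw [show (n : ℝ) ^ k = n ^ q * n ^ permLength π by rw [← pow_add, ← hq], div_pow]
        field_simp
    _ ≤ 18 ^ k * ((m : ℝ) / n) ^ permLength π * (Real.exp 1 ^ k * (n.factorial : ℝ)) := by
        exact mul_le_mul_of_nonneg_left (pow_mul_factorial_le n k hkn) (by positivity)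
    _ = _ := by rw [mul_pow]; ring

end Placement

end SymChar

theorem theorem1 :
    ∃ a : ℝ, 0 < a ∧
      ∀ (n : ℕ) (μ : YoungDiagram) (T : Fin n ≃ μ.cells) (π : Equiv.Perm (Fin n)),
        ‖SymChar.normalizedCharacter T π‖ ≤
          (a * max (max ((SymChar.numRows μ : ℝ) / (n : ℝ)) ((SymChar.numCols μ : ℝ) / (n : ℝ)))
            ((SymChar.permLength π : ℝ) / (n : ℝ))) ^ SymChar.permLength π := by
  refine ⟨2 * (18 * Real.exp 1) ^ 2, by positivity, fun n μ T π => ?_⟩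
  have hsupp := SymChar.card_support_le π
  rcases Nat.eq_zero_or_pos (SymChar.permLength π) with h0 | hpos
  · rw [h0, pow_zero]
    refine (SymChar.norm_normalizedCharacter_le T π).trans ?_
    rw [div_le_one (by positivity)]
    have := Finset.card_le_univ (SymChar.factorizable T π⁻¹)
    rw [Fintype.card_perm, Fintype.card_fin] at this
    exact_mod_cast this
  set l := SymChar.permLength π with hl
  have hπ : π ≠ 1 := fun h => by rw [hl, h, SymChar.permLength_one] at hpos; omega
  have hk0 : 0 < π.support.card := by
    rw [Finset.card_pos, Finset.nonempty_iff_ne_empty, Ne, Equiv.Perm.support_eq_empty_iff]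
    exact hπ
  have hkn : π.support.card ≤ n := by simpa using Finset.card_le_univ π.support
  set m := max (max (SymChar.numRows μ) (SymChar.numCols μ)) π.support.card with hm
  have hbound := SymChar.norm_normalizedCharacter_le_pow T π (m := m)
    ((le_max_left _ _).trans (le_max_left _ _)) ((le_max_right _ _).trans (le_max_left _ _))
    (le_max_right _ _) (max_le (max_le (SymChar.numRows_le T) (SymChar.numCols_le T)) hkn)
    (lt_of_lt_of_le hk0 (le_max_right _ _))
  have hn : (0 : ℝ) < n := Nat.cast_pos.2 (by omega)
  have hmle : (m : ℝ) / n ≤ 2 * max (max ((SymChar.numRows μ : ℝ) / (n : ℝ))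
      ((SymChar.numCols μ : ℝ) / (n : ℝ))) ((l : ℝ) / (n : ℝ)) := by
    rw [max_div_div_right hn.le, max_div_div_right hn.le, ← mul_div_assoc]
    gcongr
    have : m ≤ 2 * max (max (SymChar.numRows μ) (SymChar.numCols μ)) l := by omega
    exact_mod_cast this
  have hone : (1 : ℝ) ≤ 18 * Real.exp 1 := by
    have := Real.add_one_le_exp (1 : ℝ)
    linarith
  calc ‖SymChar.normalizedCharacter T π‖
      ≤ (18 * Real.exp 1) ^ π.support.card * ((m : ℝ) / n) ^ l := hbound
    _ ≤ (18 * Real.exp 1) ^ (2 * l) * ((m : ℝ) / n) ^ l := by gcongr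
    _ = ((18 * Real.exp 1) ^ 2 * ((m : ℝ) / n)) ^ l := by rw [pow_mul, ← mul_pow]
    _ ≤ _ := by
      gcongr ?_ ^ _
      calc _ ≤ (18 * Real.exp 1) ^ 2 * _ := mul_le_mul_of_nonneg_left hmle (by positivity)
        _ = _ := by ring
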